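/- Let $F$ be a field of characteristic $0$; algebras over $F$ are not assumed associative or unital. Let $\mathcal V=\mathrm{Jord}^{(2)}$ be the variety of metabelian Jordan algebras over $F$, i.e. the variety defined by the identities $$xy=yx,\qquad (x^2y)x=x^2(yx),\qquad (xy)(zt)=0 .$$ For a superalgebra ($\mathbb Z_2$-graded algebra) $\mathcal A=\mathcal A_0\oplus\mathcal A_1$ let $\mathrm G(\mathcal A)=\mathrm G_0\otimes\mathcal A_0+\mathrm G_1\otimes\mathcal A_1$ be its Grassmann envelope, where $\mathrm G=\mathrm G_0\oplus\mathrm G_1$ is the Grassmann algebra on countably many generators. For a multilinear polynomial $f$, the superalgebra $\mathcal A$ satisfies the superidentity $\tilde f=0$ corresponding to $f$ if $\mathrm G(\mathcal A)$ satisfies $f=0$. A $\mathcal V$-superalgebra is a superalgebra $\mathcal A$ with $\mathrm G(\mathcal A)\in\mathcal V$; $\tilde{\mathcal V}$ denotes the class of all $\mathcal V$-superalgebras. For integers $r,s\ge 0$ let $\mathcal V_{r,s}$ be the supervariety generated by the free $\mathcal V$-superalgebra on $r$ even and $s$ odd generators, i.e. the class of all superalgebras satisfying every superidentity $\tilde f=0$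 ($f$ multilinear) of that free superalgebra; in particular, $\mathcal V_{0,0}$ consists of the zero superalgebras. A pair $(r,s)$ is a basic superrank of $\mathcal V$ if $\mathcal V_{r,s}=\tilde{\mathcal V}$ and $(r,s)$ is minimal with this property for the componentwise order on pairs. The basic spectrum $\mathrm{bsp}(\mathcal V)$ is the set of all basic superranks of $\mathcal V$. Finally, let $\mathcal V_r$ be the subvariety of $\mathcal V$ generated by the free $\mathcal V$-algebra of rank $r$; the basic rank of $\mathcal V$ is the least $r$ with $\mathcal V_r=\mathcal V$, and it is infinite if there is no such $r$. Then $$\mathrm{bsp}\bigl(\mathrm{Jord}^{(2)}\bigr)=\{(0,2)\},$$ so $(0,2)$ is the unique basic superrank of $\mathrm{Jord}^{(2)}$, while the basic rank of $\mathrm{Jord}^{(2)}$ is infinite. -/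

import Mathlib

universe u

open scoped TensorProduct

noncomputable section

namespace SuperRank

/-! ### Algebras, identities and varieties -/

/-- A (not necessarily associative, not necessarily unital) algebra over the field `F`. -/
structure NAAlgebra (F : Type u) [Field F] where
  carrier : Type u
  [ring : NonUnitalNonAssocRing carrier]
  [module : Module F carrier]
  [tower : IsScalarTower F carrier carrier]
  [comm : SMulCommClass F carrier carrier]

attribute [instance] NAAlgebra.ring NAAlgebra.module NAAlgebra.tower NAAlgebra.comm

/-- Nonassociative polynomials in the variables `x₀, x₁, x₂, …` (without constant term). -/
abbrev Poly (F : Type u) [Field F] : Type u := FreeNonUnitalNonAssocAlgebra F ℕ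

variable {F : Type u} [Field F]

/-- The algebra `A` satisfies the identity `f = 0`. -/
def Satisfies (A : NAAlgebra F) (f : Poly F) : Prop :=
  ∀ a : ℕ → A.carrier, FreeNonUnitalNonAssocAlgebra.lift F a f = 0

/-- The variety of algebras defined by a system `S` of identities. -/
def variety (S : Set (Poly F)) : Set (NAAlgebra F) :=
  {A | ∀ f ∈ S, Satisfies A f}

/-- The variety generated by the algebra `A`: all algebras which satisfy every identity of `A`. -/
def varietyGeneratedBy (A : NAAlgebra F) : Set (NAAlgebra F) :=
  variety {f | Satisfies A f}

/-! ### Quotients by ideals -/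

section Quotient

variable {A : Type u} [NonUnitalNonAssocRing A] [Module F A] [IsScalarTower F A A]
  [SMulCommClass F A A]

/-- A subspace is a two-sided ideal. -/
def IsIdeal (I : Submodule F A) : Prop :=
  ∀ a b : A, b ∈ I → a * b ∈ I ∧ b * a ∈ I

/-- The multiplication of the quotient algebra `A / I`, `(a + I)(b + I) = ab + I`. -/
def quotientMul (I : Submodule F A) (hI : IsIdeal I) : A ⧸ I →ₗ[F] A ⧸ I →ₗ[F] A ⧸ I :=
  I.liftQ
    (LinearMap.mk₂ F (fun (a : A) (q : A ⧸ I) =>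
        I.mapQ I (LinearMap.mulLeft F a) (fun b hb => (hI a b hb).1) q)
      (fun a a' q => by
        induction q using Submodule.Quotient.induction_on with
        | _ b => exact congrArg I.mkQ (add_mul a a' b))
      (fun c a q => by
        induction q using Submodule.Quotient.induction_on with
        | _ b => exact congrArg I.mkQ (smul_mul_assoc c a b))
      (fun a q q' => by simp)
      (fun c a q => by simp))
    (fun a ha => by
      rw [LinearMap.mem_ker]
      ext b
      exact (Submodule.Quotient.mk_eq_zero I).2 (hI b a ha).2)

lemma quotientMul_mk (I : Submodule F A) (hI : IsIdeal I) (a b : A) :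
    quotientMul I hI (I.mkQ a) (I.mkQ b) = I.mkQ (a * b) :=
  rfl

/-- The quotient algebra `A / I`. -/
def quotientAlgebra (I : Submodule F A) (hI : IsIdeal I) : NAAlgebra F :=
  letI : NonUnitalNonAssocRing (A ⧸ I) :=
    { (inferInstance : AddCommGroup (A ⧸ I)) with
      mul := fun p q => quotientMul I hI p q
      left_distrib := fun p q t => map_add (quotientMul I hI p) q t
      right_distrib := fun p q t => LinearMap.map_add₂ (quotientMul I hI) p q t
      zero_mul := fun p => LinearMap.map_zero₂ (quotientMul I hI) p
      mul_zero := fun p => map_zero (quotientMul I hI p) }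
  { carrier := A ⧸ I
    tower := ⟨fun c p q => LinearMap.map_smul₂ (quotientMul I hI) c p q⟩
    comm := ⟨fun c p q => (map_smul (quotientMul I hI p) c q).symm⟩ }

/-- The projection of `A` onto the quotient algebra `A / I`. -/
def quotientMk (I : Submodule F A) (hI : IsIdeal I) : A →ₗ[F] (quotientAlgebra I hI).carrier :=
  I.mkQ

lemma quotientMk_mul (I : Submodule F A) (hI : IsIdeal I) (a b : A) :
    quotientMk I hI (a * b) = quotientMk I hI a * quotientMk I hI b :=
  (quotientMul_mk I hI a b).symm

lemma quotientMk_surjective (I : Submodule F A) (hI : IsIdeal I) :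
    Function.Surjective (quotientMk I hI) :=
  I.mkQ_surjective

lemma quotientMk_eq_zero (I : Submodule F A) (hI : IsIdeal I) (a : A) :
    quotientMk I hI a = 0 ↔ a ∈ I :=
  Submodule.Quotient.mk_eq_zero I

end Quotient

/-! ### Free algebras of a variety and the basic rank -/

/-- The ideal of all polynomials in the generators `X` which vanish under every substitution of
elements of every algebra of the class `V`. -/
def relations (V : Set (NAAlgebra F)) (X : Type) :
    Submodule F (FreeNonUnitalNonAssocAlgebra F X) where
  carrier := {p | ∀ B ∈ V, ∀ a : X → B.carrier, FreeNonUnitalNonAssocAlgebra.lift F a p = 0}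
  zero_mem' := fun B _ a => map_zero _
  add_mem' := fun hp hq B hB a => by rw [map_add, hp B hB a, hq B hB a, add_zero]
  smul_mem' := fun c p hp B hB a => by rw [map_smul, hp B hB a, smul_zero]

lemma relations_isIdeal (V : Set (NAAlgebra F)) (X : Type) : IsIdeal (relations V X) :=
  fun p q hq =>
    ⟨fun B hB a => by rw [map_mul, hq B hB a, mul_zero],
      fun B hB a => by rw [map_mul, hq B hB a, zero_mul]⟩

/-- The free algebra of the variety `V` on the set `X` of free generators. -/
def freeAlgebra (V : Set (NAAlgebra F)) (X : Type) : NAAlgebra F :=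
  quotientAlgebra (relations V X) (relations_isIdeal V X)

/-- The subvariety `V_r` of `V` generated by the free algebra of `V` of rank `r`. -/
def rankSubvariety (V : Set (NAAlgebra F)) (r : ℕ) : Set (NAAlgebra F) :=
  varietyGeneratedBy (freeAlgebra V (Fin r))

/-- The basic rank of `V`: the least `r` with `V_r = V`, and `⊤` if there is no such `r`. -/
def basicRank (V : Set (NAAlgebra F)) : ℕ∞ :=
  ⨅ (r : ℕ) (_ : rankSubvariety V r = V), (r : ℕ∞)

/-! ### Superalgebras and Grassmann envelopes -/

/-- A superalgebra, i.e. a `ℤ/2`-graded algebra `A = A₀ ⊕ A₁` with `Aᵢ Aⱼ ⊆ Aᵢ₊ⱼ`. -/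
structure SuperAlgebra (F : Type u) [Field F] extends NAAlgebra F where
  part : ZMod 2 → Submodule F carrier
  isCompl : IsCompl (part 0) (part 1)
  mul_mem : ∀ (i j : ZMod 2) (a b : carrier), a ∈ part i → b ∈ part j → a * b ∈ part (i + j)

variable (F) in
/-- The Grassmann algebra on countably many generators. -/
abbrev Grassmann : Type u := ExteriorAlgebra F (ℕ →₀ F)

variable (F) in
/-- The even (`i = 0`) and odd (`i = 1`) part of the Grassmann algebra: the span of the words of
even, respectively odd, length in the generators. -/
abbrev grassmannPart (i : ZMod 2) : Submodule F (Grassmann F) :=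
  CliffordAlgebra.evenOdd (0 : QuadraticForm F (ℕ →₀ F)) i

/-- The subspace `G₀ ⊗ A₀ + G₁ ⊗ A₁` of `G ⊗ A`. -/
def envelopeSubspace (A : SuperAlgebra F) : Submodule F (Grassmann F ⊗[F] A.carrier) :=
  ⨆ i : ZMod 2, LinearMap.range (TensorProduct.mapIncl (grassmannPart F i) (A.part i))

lemma tmul_mem_envelopeSubspace (A : SuperAlgebra F) {i : ZMod 2} {g : Grassmann F}
    {a : A.carrier} (hg : g ∈ grassmannPart F i) (ha : a ∈ A.part i) :
    g ⊗ₜ[F] a ∈ envelopeSubspace A :=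
  Submodule.mem_iSup_of_mem i ⟨⟨g, hg⟩ ⊗ₜ ⟨a, ha⟩, by simp [TensorProduct.mapIncl]⟩

lemma envelopeSubspace_induction (A : SuperAlgebra F)
    {P : Grassmann F ⊗[F] A.carrier → Prop} (h0 : P 0) (hadd : ∀ x y, P x → P y → P (x + y))
    (ht : ∀ (i : ZMod 2) (g : Grassmann F) (a : A.carrier), g ∈ grassmannPart F i →
      a ∈ A.part i → P (g ⊗ₜ[F] a))
    {x : Grassmann F ⊗[F] A.carrier} (hx : x ∈ envelopeSubspace A) : P x := by
  induction hx using Submodule.iSup_induction' with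
  | mem i x hx =>
    obtain ⟨t, rfl⟩ := hx
    induction t using TensorProduct.induction_on with
    | zero => simpa using h0
    | tmul g a => simpa [TensorProduct.mapIncl] using ht i g a g.2 a.2
    | add s t hs ht => rw [map_add]; exact hadd _ _ hs ht
  | zero => exact h0
  | add x y _ _ hx hy => exact hadd _ _ hx hy

lemma envelopeSubspace_mul_mem (A : SuperAlgebra F) {x y : Grassmann F ⊗[F] A.carrier}
    (hx : x ∈ envelopeSubspace A) (hy : y ∈ envelopeSubspace A) :
    x * y ∈ envelopeSubspace A := by
  refine envelopeSubspace_induction A (P := fun x => x * y ∈ envelopeSubspace A)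
    ?_ ?_ ?_ hx
  · rw [zero_mul]; exact zero_mem _
  · intro x x' hx hx'
    rw [add_mul]; exact add_mem hx hx'
  · intro i g a hg ha
    refine envelopeSubspace_induction A (P := fun y => g ⊗ₜ[F] a * y ∈ envelopeSubspace A)
      ?_ ?_ ?_ hy
    · rw [mul_zero]; exact zero_mem _
    · intro y y' hy hy'
      rw [mul_add]; exact add_mem hy hy'
    · intro j h b hh hb
      rw [Algebra.TensorProduct.tmul_mul_tmul]
      exact tmul_mem_envelopeSubspace A (SetLike.mul_mem_graded hg hh) (A.mul_mem i j a b ha hb)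

/-- The Grassmann envelope as a subalgebra of `G ⊗ A`. -/
def envelopeSubalgebra (A : SuperAlgebra F) :
    NonUnitalSubalgebra F (Grassmann F ⊗[F] A.carrier) where
  __ := envelopeSubspace A
  mul_mem' := fun hx hy => envelopeSubspace_mul_mem A hx hy

/-- The Grassmann envelope `G(A) = G₀ ⊗ A₀ + G₁ ⊗ A₁` of a superalgebra `A`. -/
def grassmannEnvelope (A : SuperAlgebra F) : NAAlgebra F where
  carrier := envelopeSubalgebra A

/-! ### Superidentities and supervarieties -/

/-- The letters of a nonassociative word, with multiplicities. -/
def letters : FreeMagma ℕ → Multiset ℕ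
  | .of n => {n}
  | .mul v w => letters v + letters w

/-- The polynomial `f` is multilinear: there is a set of variables such that each of them occurs
exactly once in each monomial of `f`, and no other variables occur. -/
def IsMultilinear (f : Poly F) : Prop :=
  ∃ X : Finset ℕ, ∀ w : FreeMagma ℕ, f.coeff w ≠ 0 → letters w = X.val

/-- The superalgebra `A` satisfies the superidentity corresponding to the identity `f = 0`
(for multilinear `f`), that is, the Grassmann envelope of `A` satisfies `f = 0`. -/
def SatisfiesSuper (A : SuperAlgebra F) (f : Poly F) : Prop :=
  Satisfies (grassmannEnvelope A) f

/-- The supervariety of all `V`-superalgebras: the superalgebras whose Grassmann envelope lies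
in `V`. -/
def superVariety (V : Set (NAAlgebra F)) : Set (SuperAlgebra F) :=
  {A | grassmannEnvelope A ∈ V}

/-- The supervariety generated by the superalgebra `A`: all superalgebras which satisfy all
superidentities (corresponding to multilinear identities) of `A`. -/
def superVarietyGeneratedBy (A : SuperAlgebra F) : Set (SuperAlgebra F) :=
  {B | ∀ f : Poly F, IsMultilinear f → SatisfiesSuper A f → SatisfiesSuper B f}

/-! ### Free superalgebras -/

section FreeSuper

variable {X : Type} (deg : X → ZMod 2)

/-- The parity of a nonassociative word in generators of given parities. -/
def wordParity : FreeMagma X → ZMod 2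
  | .of x => deg x
  | .mul v w => wordParity v + wordParity w

variable (F) in
/-- The span of all nonassociative words of parity `i`. -/
def freePart (i : ZMod 2) : Submodule F (FreeNonUnitalNonAssocAlgebra F X) :=
  Submodule.span F {p | ∃ w : FreeMagma X, wordParity deg w = i ∧ p = MonoidAlgebra.single w 1}

lemma freePart_mul_mem {i j : ZMod 2} {p q : FreeNonUnitalNonAssocAlgebra F X}
    (hp : p ∈ freePart F deg i) (hq : q ∈ freePart F deg j) :
    p * q ∈ freePart F deg (i + j) := by
  induction hp using Submodule.span_induction with
  | zero => rw [zero_mul]; exact zero_mem _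
  | add p p' _ _ hp hp' => rw [add_mul]; exact add_mem hp hp'
  | smul c p _ hp => rw [smul_mul_assoc]; exact Submodule.smul_mem _ _ hp
  | mem p hp =>
    obtain ⟨v, rfl, rfl⟩ := hp
    induction hq using Submodule.span_induction with
    | zero => rw [mul_zero]; exact zero_mem _
    | add q q' _ _ hq hq' => rw [mul_add]; exact add_mem hq hq'
    | smul c q _ hq => rw [mul_smul_comm]; exact Submodule.smul_mem _ _ hq
    | mem q hq =>
      obtain ⟨w, rfl, rfl⟩ := hq
      exact Submodule.subset_span ⟨v * w, rfl, by rw [MonoidAlgebra.single_mul_single, one_mul]⟩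

variable (F) in
lemma freePart_sup : freePart F deg 0 ⊔ freePart F deg 1 = ⊤ := by
  rw [eq_top_iff]
  rintro p -
  induction p using MonoidAlgebra.induction_linear with
  | zero => exact zero_mem _
  | add p q hp hq => exact add_mem hp hq
  | single w c =>
    have hc : (MonoidAlgebra.single w c : FreeNonUnitalNonAssocAlgebra F X)
        = c • MonoidAlgebra.single w 1 := by simp
    rw [hc]
    refine Submodule.smul_mem _ _ ?_
    have h2 : ∀ i : ZMod 2, i = 0 ∨ i = 1 := by decide
    rcases h2 (wordParity deg w) with h | h
    · exact Submodule.mem_sup_left (Submodule.subset_span ⟨w, h, rfl⟩)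
    · exact Submodule.mem_sup_right (Submodule.subset_span ⟨w, h, rfl⟩)

lemma lift_mem_part (B : SuperAlgebra F) {a : X → B.carrier} (ha : ∀ x, a x ∈ B.part (deg x))
    {i : ZMod 2} {p : FreeNonUnitalNonAssocAlgebra F X} (hp : p ∈ freePart F deg i) :
    FreeNonUnitalNonAssocAlgebra.lift F a p ∈ B.part i := by
  induction hp using Submodule.span_induction with
  | zero => rw [map_zero]; exact zero_mem _
  | add p q _ _ hp hq => rw [map_add]; exact add_mem hp hq
  | smul c p _ hp => rw [map_smul]; exact Submodule.smul_mem _ _ hp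
  | mem p hp =>
    obtain ⟨w, rfl, rfl⟩ := hp
    induction w with
    | ih1 x =>
      have : FreeNonUnitalNonAssocAlgebra.lift F a (MonoidAlgebra.single (FreeMagma.of x) 1)
          = a x := FreeNonUnitalNonAssocAlgebra.lift_of_apply F a x
      rw [this]; exact ha x
    | ih2 v w hv hw =>
      have : (MonoidAlgebra.single (v * w) 1 : FreeNonUnitalNonAssocAlgebra F X)
          = MonoidAlgebra.single v 1 * MonoidAlgebra.single w 1 := by
        rw [MonoidAlgebra.single_mul_single, one_mul]
      rw [this, map_mul]
      exact B.mul_mem _ _ _ _ hv hw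

/-- The ideal of all polynomials in the generators `X` which vanish under every substitution of
even elements for even generators and odd elements for odd generators in every superalgebra of
the class `V`. -/
def superRelations (V : Set (SuperAlgebra F)) :
    Submodule F (FreeNonUnitalNonAssocAlgebra F X) where
  carrier := {p | ∀ B ∈ V, ∀ a : X → B.carrier, (∀ x, a x ∈ B.part (deg x)) →
    FreeNonUnitalNonAssocAlgebra.lift F a p = 0}
  zero_mem' := fun B _ a _ => map_zero _
  add_mem' := fun hp hq B hB a ha => by rw [map_add, hp B hB a ha, hq B hB a ha, add_zero]
  smul_mem' := fun c p hp B hB a ha => by rw [map_smul, hp B hB a ha, smul_zero]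

lemma superRelations_isIdeal (V : Set (SuperAlgebra F)) : IsIdeal (superRelations deg V) :=
  fun p q hq =>
    ⟨fun B hB a ha => by rw [map_mul, hq B hB a ha, mul_zero],
      fun B hB a ha => by rw [map_mul, hq B hB a ha, zero_mul]⟩

/-- The free superalgebra of the class `V` on the set `X` of homogeneous free generators of
parities `deg`. -/
def freeSuperAlgebra (V : Set (SuperAlgebra F)) : SuperAlgebra F where
  toNAAlgebra := quotientAlgebra (superRelations deg V) (superRelations_isIdeal deg V)
  part i := (freePart F deg i).map (quotientMk _ (superRelations_isIdeal deg V))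
  isCompl := by
    constructor
    · rw [Submodule.disjoint_def]
      rintro _ ⟨p, hp, rfl⟩ ⟨q, hq, hqp⟩
      refine (quotientMk_eq_zero _ _ _).2 fun B hB a ha => ?_
      have h1 : FreeNonUnitalNonAssocAlgebra.lift F a q
          = FreeNonUnitalNonAssocAlgebra.lift F a p := by
        rw [← sub_eq_zero, ← map_sub] at hqp
        have := (quotientMk_eq_zero _ _ _).1 hqp B hB a ha
        rwa [map_sub, sub_eq_zero] at this
      exact Submodule.disjoint_def.1 B.isCompl.disjoint _ (lift_mem_part deg B ha hp)
        (h1 ▸ lift_mem_part deg B ha hq)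
    · rw [codisjoint_iff, ← Submodule.map_sup, freePart_sup, Submodule.map_top,
        LinearMap.range_eq_top]
      exact quotientMk_surjective _ _
  mul_mem := by
    rintro i j _ _ ⟨p, hp, rfl⟩ ⟨q, hq, rfl⟩
    exact ⟨p * q, freePart_mul_mem deg hp hq, quotientMk_mul _ _ p q⟩

end FreeSuper

/-! ### Basic superranks and the basic spectrum -/

/-- The parities of `r` even and `s` odd generators. -/
def genParity (r s : ℕ) : Fin r ⊕ Fin s → ZMod 2 :=
  Sum.elim (fun _ => 0) (fun _ => 1)

/-- The supervariety `V_{r,s}` generated by the free `V`-superalgebra on `r` even and `s` odd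
generators. For `r = s = 0` the free superalgebra is zero, and so `V_{0,0}` consists of the zero
superalgebras. -/
def superRankSubvariety (V : Set (NAAlgebra F)) (r s : ℕ) : Set (SuperAlgebra F) :=
  superVarietyGeneratedBy (freeSuperAlgebra (genParity r s) (superVariety V))

/-- The pair `(r, s)` is a basic superrank of `V`: it is minimal, with respect to the
componentwise order, among the pairs for which `V_{r,s}` is the supervariety of all
`V`-superalgebras. -/
def IsBasicSuperrank (V : Set (NAAlgebra F)) (p : ℕ × ℕ) : Prop :=
  Minimal (fun q : ℕ × ℕ => superRankSubvariety V q.1 q.2 = superVariety V) p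

/-- The basic spectrum of `V`: the set of all its (finite) basic superranks. -/
def basicSpectrum (V : Set (NAAlgebra F)) : Set (ℕ × ℕ) :=
  {p | IsBasicSuperrank V p}

/-! ### Metabelian Jordan algebras -/

variable (F) in
/-- The variable `xₙ`. -/
abbrev var (n : ℕ) : Poly F := FreeNonUnitalNonAssocAlgebra.of F n

variable (F) in
/-- Commutativity, `xy - yx`. -/
def commutativity : Poly F := var F 0 * var F 1 - var F 1 * var F 0

variable (F) in
/-- The Jordan identity `(x², y, x) = (x² y) x - x² (y x)`. -/
def jordanIdentity : Poly F :=
  ((var F 0 * var F 0) * var F 1) * var F 0 - (var F 0 * var F 0) * (var F 1 * var F 0)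

variable (F) in
/-- Metabelianity (solvability of index at most two), `(xy)(zt)`. -/
def metabelianity : Poly F := (var F 0 * var F 1) * (var F 2 * var F 3)

variable (F) in
/-- The variety of metabelian Jordan algebras over `F`. -/
def metabelianJordan : Set (NAAlgebra F) :=
  variety {commutativity F, jordanIdentity F, metabelianity F}

end SuperRank

end

noncomputable section

namespace SuperRank

variable {F : Type u} [Field F]

/-! In a commutative metabelian algebra the linearised Jordan identity reads `jordanForm x y z t =
0`. If one argument is itself a product `w`, one term dies by metabelianity and what remains is `w a
b c = -w c b a`. Hence a left-normed word `w s₁ t₁ s₂ t₂ ⋯` is alternating in the `s`'s and,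
separately, in the `t`'s (`zigzag_alternating_of_mem`). Two alternating sets of variables suggest
two odd generators.

Upper bound. The zigzag superalgebra, generated by odd `x` and `y`, multiplies `m₀` alternately by
`x` and `y` and kills every other continuation. Put `1 ⊗ m₀` for one variable of a multilinear
identity and `gen j ⊗ x` or `gen j ⊗ y` for the others: only words having that variable among their
first two letters, with `x` and `y` in the right places, survive. The surviving coefficients,
weighted by signs, sum to zero. Since any two nonvanishing doubly alternating functions obey the
same sign rules, this relation passes to every doubly alternating function
(`sum_eq_zero_of_alternating`), in particular to `zigzagSum` in an arbitrary metabelian Jordan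
algebra. Adding the relations over the two heads of each word returns the word itself times a
positive integer (`zigzagSum_add_zigzagSum`), which is invertible in characteristic zero. So
multilinear identities of the zigzag superalgebra hold throughout the variety (`sum_words_eq_zero`),
and so do those of the free superalgebra on two odd generators, which maps onto it.

Lower bound. Apply `R_y R_z + R_z R_y` repeatedly to a product (`symProd`). With at most one odd
generator, two odd entries cancel and products annihilate, so each pair must contain one of the `r`
even generators, on one of two sides. After `2r + 1` pairs some generator repeats on the same side,
and alternation kills the word. In the zigzag superalgebra `symProd` never vanishes identically, so
at least two odd generators are needed. The same identity, tested on the Grassmann envelope of the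
zigzag superalgebra, excludes every finite basic rank. -/

/-! ### Alternating functions of lists -/

/-- A function of lists which changes sign when two neighbouring entries are interchanged. -/
def ListAlternating {α : Type*} {W : Type*} [AddGroup W] (g : List α → W) : Prop :=
  ∀ (l₁ : List α) (a b : α) (l₂ : List α), g (l₁ ++ a :: b :: l₂) = -g (l₁ ++ b :: a :: l₂)

lemma ListAlternating.cons {α W : Type*} [AddGroup W] {g : List α → W}
    (hg : ListAlternating g) (a : α) : ListAlternating fun l => g (a :: l) :=
  fun l₁ b c l₂ => hg (a :: l₁) b c l₂

lemma ListAlternating.comp_map {α β W : Type*} [AddGroup W] {g : List α → W}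
    (hg : ListAlternating g) (f : β → α) : ListAlternating fun l => g (l.map f) :=
  fun l₁ a b l₂ => by
    simpa only [List.map_append, List.map_cons] using hg (l₁.map f) (f a) (f b) (l₂.map f)

/-- The point is the order of the quantifiers: one sign serves all alternating functions at once, so
relations can be carried from one such function to another. -/
lemma exists_sign_of_perm {α : Type*} {l l' : List α} (h : l.Perm l') :
    ∃ ε : ℤˣ, ∀ (W : Type u) [AddCommGroup W] (g : List α → W), ListAlternating g →
      g l = (ε : ℤ) • g l' := by
  induction h with
  | nil => exact ⟨1, fun W _ g _ => by simp⟩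
  | cons x _ ih =>
    obtain ⟨ε, hε⟩ := ih
    exact ⟨ε, fun W _ g hg => hε W _ (hg.cons x)⟩
  | swap x y l => exact ⟨-1, fun W _ g hg => by simpa using hg [] y x l⟩
  | trans _ _ ih₁ ih₂ =>
    obtain ⟨ε, hε⟩ := ih₁
    obtain ⟨δ, hδ⟩ := ih₂
    exact ⟨ε * δ, fun W _ g hg => by rw [hε W g hg, hδ W g hg, smul_smul, Units.val_mul]⟩

/-- The alternating sum over all ways of extracting one entry of a list. -/
def laplaceSum {α W : Type*} [AddCommGroup W] : (α → List α → W) → List α → W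
  | _, [] => 0
  | G, t :: T => G t T - laplaceSum (fun t' T' => G t' (t :: T')) T

lemma laplaceSum_neg {α W : Type*} [AddCommGroup W] (G : α → List α → W) (T : List α) :
    laplaceSum (fun t l => -G t l) T = -laplaceSum G T := by
  induction T generalizing G with
  | nil => simp [laplaceSum]
  | cons t T ih => simp only [laplaceSum, ih]; abel

lemma laplaceSum_add {α W : Type*} [AddCommGroup W] (G H : α → List α → W) (T : List α) :
    laplaceSum (fun t l => G t l + H t l) T = laplaceSum G T + laplaceSum H T := by
  induction T generalizing G H with
  | nil => simp [laplaceSum]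
  | cons t T ih => simp only [laplaceSum, ih]; abel

/-- The terms extracting one of the two neighbours are exchanged with opposite signs; in all others
both neighbours stay in the list and `hG` applies. -/
lemma laplaceSum_alternating {α W : Type*} [AddCommGroup W] {G : α → List α → W}
    (hG : ∀ t, ListAlternating (G t)) : ListAlternating (laplaceSum G) := by
  intro l₁
  induction l₁ generalizing G with
  | nil =>
    intro a b l
    have h : (fun t T => G t (a :: b :: T)) = fun t T => -G t (b :: a :: T) :=
      funext fun t => funext fun T => hG t [] a b T
    simp only [List.nil_append, laplaceSum, h, laplaceSum_neg]
    abel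
  | cons c l₁ ih =>
    intro a b l
    simp only [List.cons_append, laplaceSum, ih (fun t => (hG t).cons c) a b l, hG c l₁ a b l]
    abel

/-- Returning the extracted entry to its place costs exactly the Laplace sign, so every summand
equals `g T`. -/
lemma laplaceSum_cons_of_alternating {α W : Type*} [AddCommGroup W] {g : List α → W}
    (hg : ListAlternating g) (T : List α) :
    laplaceSum (fun t l => g (t :: l)) T = T.length • g T := by
  induction T generalizing g with
  | nil => simp [laplaceSum]
  | cons t T ih =>
    have h : (fun t' l => g (t' :: t :: l)) = fun t' l => -g (t :: t' :: l) :=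
      funext fun t' => funext fun l => hg [] t' t l
    simp only [laplaceSum, h, laplaceSum_neg, ih (hg.cons t), List.length_cons, succ_nsmul]
    abel

/-- If a combination of values of a nonvanishing function, alternating in both arguments, vanishes
on each class of pairs of lists with the same entries, then so does the same combination of values
of every function which is alternating in both arguments. -/
lemma sum_eq_zero_of_alternating {F : Type*} [Field F] {κ : Type*} (s : Finset κ) (c : κ → F)
    (T S : κ → List ℕ) {Y : List ℕ} (hY : Y.Nodup) (hTS : ∀ k ∈ s, (T k ++ S k).Perm Y)
    {W W' : Type u} [AddCommGroup W] [Module F W] [AddCommGroup W'] [Module F W']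
    (ξ : List ℕ → List ℕ → W') (hξ₁ : ∀ S, ListAlternating fun T => ξ T S)
    (hξ₂ : ∀ T, ListAlternating (ξ T)) (hξ : ∀ k ∈ s, ξ (T k) (S k) ≠ 0)
    (h : ∀ k₀ ∈ s, ∑ k ∈ s with (T k).toFinset = (T k₀).toFinset, c k • ξ (T k) (S k) = 0)
    (g : List ℕ → List ℕ → W) (hg₁ : ∀ S, ListAlternating fun T => g T S)
    (hg₂ : ∀ T, ListAlternating (g T)) :
    ∑ k ∈ s, c k • g (T k) (S k) = 0 := by
  classical
  -- Since `T k ++ S k` permutes a fixed duplicate-free list, the set of entries of `T k` determines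
  -- both lists up to order; inside a fibre everything is a signed copy of one value.
  rw [← Finset.sum_fiberwise_of_maps_to (t := s.image fun k => (T k).toFinset)
    (g := fun k => (T k).toFinset) (fun k hk => Finset.mem_image_of_mem _ hk)]
  refine Finset.sum_eq_zero fun T₀ hT₀ => ?_
  obtain ⟨k₀, hk₀, rfl⟩ := Finset.mem_image.1 hT₀
  have key : ∀ k, ∃ ε : ℤ, k ∈ s → (T k).toFinset = (T k₀).toFinset →
      ξ (T k) (S k) = ε • ξ (T k₀) (S k₀) ∧ g (T k) (S k) = ε • g (T k₀) (S k₀) := by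
    intro k
    by_cases hk : k ∈ s ∧ (T k).toFinset = (T k₀).toFinset
    swap
    · exact ⟨0, fun h₁ h₂ => absurd ⟨h₁, h₂⟩ hk⟩
    obtain ⟨hk, hT⟩ := hk
    have n₁ := (hTS k hk).nodup_iff.2 hY
    have n₀ := (hTS k₀ hk₀).nodup_iff.2 hY
    have pT : (T k).Perm (T k₀) :=
      List.perm_of_nodup_nodup_toFinset_eq n₁.of_append_left n₀.of_append_left hT
    have pS : (S k).Perm (S k₀) :=
      (List.perm_append_left_iff (T k₀)).1
        ((pT.symm.append_right (S k)).trans ((hTS k hk).trans (hTS k₀ hk₀).symm))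
    obtain ⟨ε, hε⟩ := exists_sign_of_perm.{u} pT
    obtain ⟨δ, hδ⟩ := exists_sign_of_perm.{u} pS
    refine ⟨ε * δ, fun _ _ => ⟨?_, ?_⟩⟩
    · rw [hε W' _ (hξ₁ (S k)), hδ W' _ (hξ₂ _), smul_smul]
    · rw [hε W _ (hg₁ (S k)), hδ W _ (hg₂ _), smul_smul]
  choose ε hε using key
  have h₁ := h k₀ hk₀
  have h₂ : (∑ k ∈ s with (T k).toFinset = (T k₀).toFinset, c k * (ε k : F)) •
      ξ (T k₀) (S k₀) = 0 := by
    rw [← h₁, Finset.sum_smul]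
    refine Finset.sum_congr rfl fun k hk => ?_
    rw [Finset.mem_filter] at hk
    rw [(hε k hk.1 hk.2).1, mul_smul, Int.cast_smul_eq_zsmul]
  -- Nonvanishing of `ξ` forces the signed sum of coefficients to vanish, and the same scalar
  -- multiplies `g (T k₀) (S k₀)`.
  have h₃ := (smul_eq_zero.1 h₂).resolve_right (hξ k₀ hk₀)
  rw [← zero_smul F (g (T k₀) (S k₀)), ← h₃, Finset.sum_smul]
  refine Finset.sum_congr rfl fun k hk => ?_
  rw [Finset.mem_filter] at hk
  rw [(hε k hk.1 hk.2).2, mul_smul, Int.cast_smul_eq_zsmul]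

/-! ### Alternate products -/

/-- The product `(((w s₁) t₁) s₂) t₂ ⋯` of an element with the entries of two lists, taken in
turn; it is zero if the lengths of the lists do not fit. -/
def zigzag {R : Type*} [Mul R] [Zero R] : R → List R → List R → R
  | w, [], [] => w
  | _, [], _ :: _ => 0
  | w, s :: S, T => zigzag (w * s) T S
  termination_by _ S T => S.length + T.length
  decreasing_by simp; omega

/-- The entries of a list in odd and in even positions. -/
def splitList {α : Type*} : List α → List α × List α
  | [] => ([], [])
  | a :: l => (a :: (splitList l).2, (splitList l).1)

lemma splitList_map {α β : Type*} (f : α → β) (l : List α) :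
    splitList (l.map f) = ((splitList l).1.map f, (splitList l).2.map f) := by
  induction l with
  | nil => rfl
  | cons a l ih => simp [splitList, ih]

lemma splitList_perm {α : Type*} (l : List α) :
    ((splitList l).1 ++ (splitList l).2).Perm l := by
  induction l with
  | nil => rfl
  | cons a l ih => exact (List.perm_append_comm.trans ih).cons a

lemma zigzag_splitList {R : Type*} [Mul R] [Zero R] (w : R) (l : List R) :
    zigzag w (splitList l).1 (splitList l).2 = l.foldl (· * ·) w := by
  induction l generalizing w with
  | nil => simp [splitList, zigzag]
  | cons a l ih => simp [splitList, zigzag, ih]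

section Zigzag

variable {R : Type*} [NonUnitalNonAssocRing R]

lemma zigzag_cons (w s : R) (S T : List R) : zigzag w (s :: S) T = zigzag (w * s) T S := by
  rw [zigzag]

lemma zigzag_nil_cons (w t : R) (T : List R) : zigzag w [] (t :: T) = 0 := by
  rw [zigzag]

lemma zigzag_add (w w' : R) (S T : List R) :
    zigzag (w + w') S T = zigzag w S T + zigzag w' S T := by
  induction hn : S.length + T.length using Nat.strong_induction_on generalizing w w' S T with
  | _ n ih =>
    cases S with
    | nil => cases T <;> simp [zigzag]
    | cons s S =>
      simp only [zigzag_cons, add_mul]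
      exact ih (T.length + S.length) (by simp at hn; omega) _ _ _ _ rfl

lemma zigzag_zero (S T : List R) : zigzag (0 : R) S T = 0 := by
  simpa using zigzag_add (0 : R) 0 S T

lemma zigzag_neg (w : R) (S T : List R) : zigzag (-w) S T = -zigzag w S T :=
  eq_neg_of_add_eq_zero_left (by rw [← zigzag_add, neg_add_cancel, zigzag_zero])

/-- If the right multiplications by the elements `φ i` satisfy `R_a R_b R_c = - R_c R_b R_a` on a
stable set, then alternate products of these elements are alternating in both lists. -/
lemma zigzag_map_alternating {ι : Type*} (φ : ι → R) {P : R → Prop}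
    (hP : ∀ w i, P w → P (w * φ i))
    (h : ∀ w a b c, P w → w * φ a * φ b * φ c = -(w * φ c * φ b * φ a)) {w : R} (hw : P w) :
    (∀ T : List ι, ListAlternating fun S : List ι => zigzag w (S.map φ) (T.map φ)) ∧
      ∀ S : List ι, ListAlternating fun T : List ι => zigzag w (S.map φ) (T.map φ) := by
  have key : ∀ n : ℕ, ∀ w, P w → ∀ (l₁ : List ι) (a b : ι) (l₂ T : List ι),
      l₁.length + l₂.length + T.length ≤ n →
      zigzag w ((l₁ ++ a :: b :: l₂).map φ) (T.map φ)
        = -zigzag w ((l₁ ++ b :: a :: l₂).map φ) (T.map φ) ∧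
      zigzag w (T.map φ) ((l₁ ++ a :: b :: l₂).map φ)
        = -zigzag w (T.map φ) ((l₁ ++ b :: a :: l₂).map φ) := by
    intro n
    induction n using Nat.strong_induction_on with
    | _ n ih =>
      intro w hw l₁ a b l₂ T hn
      have h₁ : ∀ w, P w → ∀ l₁ T : List ι, l₁.length + l₂.length + T.length ≤ n →
          zigzag w ((l₁ ++ a :: b :: l₂).map φ) (T.map φ)
            = -zigzag w ((l₁ ++ b :: a :: l₂).map φ) (T.map φ) := by
        intro w hw l₁ T hn
        cases l₁ with
        | nil =>
          -- With `T` empty both sides contain two consecutive unmatched factors and are zero by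
          -- definition.
          cases T with
          | nil => simp [zigzag_cons, zigzag_nil_cons]
          | cons t T =>
            simp only [List.nil_append, List.map_cons, zigzag_cons]
            rw [h w a t b hw, zigzag_neg]
        | cons c l₁ =>
          simp only [List.cons_append, List.map_cons, zigzag_cons]
          simp only [List.length_cons] at hn
          -- Peeling off `c` exchanges the roles of the lists, which is why both alternations are
          -- proved in one induction.
          exact (ih (l₁.length + l₂.length + T.length) (by omega) _ (hP w c hw) l₁ a b l₂ T
            le_rfl).2
      refine ⟨h₁ w hw l₁ T hn, ?_⟩
      cases T with
      | nil => cases l₁ <;> simp [zigzag_nil_cons]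
      | cons t T =>
        simp only [List.map_cons, zigzag_cons]
        simp only [List.length_cons] at hn
        exact h₁ _ (hP w t hw) l₁ T (by omega)
  exact ⟨fun T l₁ a b l₂ => (key _ w hw l₁ a b l₂ T le_rfl).1,
    fun S l₁ a b l₂ => (key _ w hw l₁ a b l₂ S le_rfl).2⟩

end Zigzag

/-! ### Identities and normal forms in metabelian Jordan algebras -/

section MetabelianJordan

lemma lift_var (B : NAAlgebra F) (a : ℕ → B.carrier) (n : ℕ) :
    FreeNonUnitalNonAssocAlgebra.lift F a (var F n) = a n :=
  FreeNonUnitalNonAssocAlgebra.lift_of_apply F a n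

/-- The left-hand side of the linearised Jordan identity in metabelian commutative algebras. -/
def jordanForm {R : Type*} [NonUnitalNonAssocRing R] (x y z t : R) : R :=
  x * y * t * z + x * z * t * y + y * z * t * x

lemma satisfies_commutativity_iff (B : NAAlgebra F) :
    Satisfies B (commutativity F) ↔ ∀ a b : B.carrier, a * b = b * a := by
  constructor
  · intro h a b
    have := h fun n => if n = 0 then a else b
    simpa [commutativity, lift_var, sub_eq_zero] using this
  · intro h a
    simp [commutativity, h (a 0)]

lemma satisfies_metabelianity_iff (B : NAAlgebra F) :
    Satisfies B (metabelianity F) ↔ ∀ a b c d : B.carrier, (a * b) * (c * d) = 0 := by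
  constructor
  · intro h a b c d
    have := h fun n => if n = 0 then a else if n = 1 then b else if n = 2 then c else d
    simpa [metabelianity, lift_var] using this
  · intro h a
    simp [metabelianity, h]

lemma lift_eq_sum (B : NAAlgebra F) (f : Poly F) (a : ℕ → B.carrier) :
    FreeNonUnitalNonAssocAlgebra.lift F a f
      = ∑ w ∈ f.coeff.support, f.coeff w • FreeMagma.lift a w := by
  simp [FreeNonUnitalNonAssocAlgebra.lift, Finsupp.sum]

variable [CharZero F]

/-- Metabelianity removes `x²(yx)`, leaving an expression cubic in `x`. Its polarisation by
inclusion-exclusion is twice `jordanForm`, and putting `x = y = z` back gives three times the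
original; both constants are invertible. -/
lemma satisfies_jordanIdentity_iff (B : NAAlgebra F) (hc : ∀ a b : B.carrier, a * b = b * a)
    (hm : ∀ a b c d : B.carrier, (a * b) * (c * d) = 0) :
    Satisfies B (jordanIdentity F) ↔ ∀ x y z t : B.carrier, jordanForm x y z t = 0 := by
  have h₁ : Satisfies B (jordanIdentity F) ↔ ∀ x y : B.carrier, x * x * y * x = 0 := by
    constructor
    · intro h a b
      have := h fun n => if n = 0 then a else b
      simpa [jordanIdentity, lift_var, hm] using this
    · intro h a
      simp [jordanIdentity, h, hm]
  rw [h₁]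
  constructor
  · intro h x y z t
    have e : (2 : F) • jordanForm x y z t = 0 := by
      have e₁ := h (x + y + z) t
      have e₂ := h (x + y) t
      have e₃ := h (x + z) t
      have e₄ := h (y + z) t
      have e₅ := h x t
      have e₆ := h y t
      have e₇ := h z t
      have : (2 : F) • jordanForm x y z t
          = (x + y + z) * (x + y + z) * t * (x + y + z) - (x + y) * (x + y) * t * (x + y)
            - (x + z) * (x + z) * t * (x + z) - (y + z) * (y + z) * t * (y + z)
            + x * x * t * x + y * y * t * y + z * z * t * z := by
        simp only [jordanForm, two_smul, add_mul, mul_add, hc y x, hc z x, hc z y]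
        abel
      rw [this, e₁, e₂, e₃, e₄, e₅, e₆, e₇]
      simp
    exact (smul_eq_zero.1 e).resolve_left two_ne_zero
  · intro h x y
    have e : (3 : F) • (x * x * y * x) = 0 := by
      have e₁ := h x x x y
      have : (3 : F) = 1 + 1 + 1 := by norm_num
      rw [this, add_smul, add_smul, one_smul]
      exact e₁
    exact (smul_eq_zero.1 e).resolve_left three_ne_zero

lemma mem_metabelianJordan_iff (B : NAAlgebra F) :
    B ∈ metabelianJordan F ↔ (∀ a b : B.carrier, a * b = b * a) ∧
      (∀ a b c d : B.carrier, (a * b) * (c * d) = 0) ∧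
      ∀ x y z t : B.carrier, jordanForm x y z t = 0 := by
  have : B ∈ metabelianJordan F ↔ Satisfies B (commutativity F) ∧
      Satisfies B (jordanIdentity F) ∧ Satisfies B (metabelianity F) := by
    simp [metabelianJordan, variety]
  rw [this, satisfies_commutativity_iff, satisfies_metabelianity_iff]
  constructor
  · rintro ⟨h₁, h₂, h₃⟩
    exact ⟨h₁, h₃, (satisfies_jordanIdentity_iff B h₁ h₃).1 h₂⟩
  · rintro ⟨h₁, h₃, h₂⟩
    exact ⟨h₁, (satisfies_jordanIdentity_iff B h₁ h₃).2 h₂, h₃⟩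

section Variety

variable {B : NAAlgebra F} (hB : B ∈ metabelianJordan F)
include hB

lemma mul_comm_of_mem (a b : B.carrier) : a * b = b * a :=
  ((mem_metabelianJordan_iff B).1 hB).1 a b

lemma mul_mul_mul_eq_zero (a b c d : B.carrier) : (a * b) * (c * d) = 0 :=
  ((mem_metabelianJordan_iff B).1 hB).2.1 a b c d

lemma jordanForm_eq_zero (x y z t : B.carrier) : jordanForm x y z t = 0 :=
  ((mem_metabelianJordan_iff B).1 hB).2.2 x y z t

/-- Of the three terms of `jordanForm w a c b`, the one ending in `w` is a product of two products.
-/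
lemma mul_mul_mul_skew {w : B.carrier} (hw : ∃ p q, w = p * q) (a b c : B.carrier) :
    w * a * b * c = -(w * c * b * a) := by
  obtain ⟨p, q, rfl⟩ := hw
  have h := jordanForm_eq_zero hB (p * q) a c b
  have h₁ : a * c * b * (p * q) = 0 := mul_mul_mul_eq_zero hB _ _ _ _
  rw [jordanForm, h₁, add_zero] at h
  exact eq_neg_of_add_eq_zero_left h

lemma zigzag_alternating_of_mem {w : B.carrier} (hw : ∃ p q, w = p * q) :
    (∀ T, ListAlternating fun S => zigzag w S T) ∧ ∀ S, ListAlternating (zigzag w S) := by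
  have h := zigzag_map_alternating (fun a => a) (P := fun w : B.carrier => ∃ p q, w = p * q)
    (fun w a _ => ⟨w, a, rfl⟩) (fun _ a b c hw => mul_mul_mul_skew hB hw a b c) hw
  simpa only [List.map_id'] using h

/-- This is `jordanForm x y z s = 0`, with `s` the first entry of `S`, followed by the common tail.
For empty `S` every term is zero because the list lengths do not fit. -/
lemma zigzag_jordan (x y z : B.carrier) (S T : List B.carrier) :
    zigzag (x * z) S (y :: T) + zigzag (y * z) S (x :: T) = -zigzag (x * y) S (z :: T) := by
  cases S with
  | nil => simp [zigzag_nil_cons]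
  | cons s S =>
    simp only [zigzag_cons]
    have h := jordanForm_eq_zero hB x y z s
    rw [← zigzag_add]
    rw [← zigzag_neg]
    congr 1
    rw [jordanForm] at h
    rw [eq_neg_iff_add_eq_zero, ← h]
    abel

end Variety

/-- The alternating sum of the products `(u t) s₁ t₁ s₂ t₂ ⋯` over all entries `t` of `T`,
where `t₁, t₂, …` are the remaining entries. -/
def zigzagSum {R : Type*} [NonUnitalNonAssocRing R] (u : R) (T S : List R) : R :=
  laplaceSum (fun t T' => zigzag (u * t) S T') T

section Variety

variable {B : NAAlgebra F} (hB : B ∈ metabelianJordan F)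
include hB

lemma zigzagSum_alternating_left (u : B.carrier) (S : List B.carrier) :
    ListAlternating fun T => zigzagSum u T S :=
  laplaceSum_alternating fun t => (zigzag_alternating_of_mem hB ⟨u, t, rfl⟩).2 S

lemma zigzagSum_alternating_right (u : B.carrier) (T : List B.carrier) :
    ListAlternating (zigzagSum u T) := by
  intro l₁ a b l₂
  have h : (fun t T' => zigzag (u * t) (l₁ ++ a :: b :: l₂) T') =
      fun t T' => -zigzag (u * t) (l₁ ++ b :: a :: l₂) T' :=
    funext fun t => funext fun T' => (zigzag_alternating_of_mem hB ⟨u, t, rfl⟩).1 T' l₁ a b l₂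
  rw [zigzagSum, h, laplaceSum_neg, zigzagSum]

/-- Inversion formula recovering a word from the sums attached to its two heads. Extracting `y`,
respectively `x`, gives two copies of the word by commutativity. The remaining terms combine by
`zigzag_jordan`, and the resulting Laplace sum supplies one further copy for each entry of `T`. -/
lemma zigzagSum_add_zigzagSum (x y : B.carrier) (T S : List B.carrier) :
    zigzagSum x (y :: T) S + zigzagSum y (x :: T) S = (T.length + 2) • zigzag (x * y) S T := by
  have h₁ : laplaceSum (fun t T' => zigzag (x * t) S (y :: T')) T
      + laplaceSum (fun t T' => zigzag (y * t) S (x :: T')) T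
      = -(T.length • zigzag (x * y) S T) := by
    rw [← laplaceSum_add]
    simp only [zigzag_jordan hB]
    rw [laplaceSum_neg,
      laplaceSum_cons_of_alternating ((zigzag_alternating_of_mem hB ⟨x, y, rfl⟩).2 S)]
  rw [zigzagSum, zigzagSum, laplaceSum, laplaceSum, mul_comm_of_mem hB y x, sub_add_sub_comm, h₁,
    add_smul, two_smul]
  abel

end Variety

/-! ### Left-normed words -/

lemma foldl_mul_eq_mul {R : Type*} [Mul R] (w : R) {l : List R} (hl : l ≠ []) :
    ∃ p q, l.foldl (· * ·) w = p * q := by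
  induction l using List.reverseRecOn with
  | nil => exact absurd rfl hl
  | append_singleton l a => exact ⟨_, a, by rw [List.foldl_append]; rfl⟩

variable (F) in
/-- In metabelian Jordan algebras every word either vanishes or equals a left-normed word. -/
lemma exists_leftNormed (w : FreeMagma ℕ) :
    (∀ B ∈ metabelianJordan F, ∀ a : ℕ → B.carrier, FreeMagma.lift a w = 0) ∨
    ∃ (i : ℕ) (l : List ℕ), ((i :: l : List ℕ) : Multiset ℕ) = letters w ∧
      ∀ B ∈ metabelianJordan F, ∀ a : ℕ → B.carrier,
        FreeMagma.lift a w = (l.map a).foldl (· * ·) (a i) := by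
  induction w with
  | ih1 n => exact Or.inr ⟨n, [], rfl, fun B _ a => rfl⟩
  | ih2 v w hv hw =>
    rcases hv with hv | ⟨i, l, hl, hv⟩
    · exact Or.inl fun B hB a => by rw [map_mul, hv B hB a, zero_mul]
    rcases hw with hw | ⟨j, m, hm, hw⟩
    · exact Or.inl fun B hB a => by rw [map_mul, hw B hB a, mul_zero]
    have hlet : letters (v * w) = letters v + letters w := rfl
    rcases eq_or_ne m [] with rfl | hm'
    · refine Or.inr ⟨i, l ++ [j], ?_, fun B hB a => ?_⟩
      · rw [hlet, ← hl, ← hm, Multiset.coe_add]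
        rfl
      · rw [map_mul, hv B hB a, hw B hB a]
        simp
    rcases eq_or_ne l [] with rfl | hl'
    · refine Or.inr ⟨j, m ++ [i], ?_, fun B hB a => ?_⟩
      · rw [hlet, ← hl, ← hm, add_comm, Multiset.coe_add]
        rfl
      · rw [map_mul, hv B hB a, hw B hB a, mul_comm_of_mem hB]
        simp
    -- Both factors have degree at least two here, so metabelianity kills their product.
    · refine Or.inl fun B hB a => ?_
      rw [map_mul, hv B hB a, hw B hB a]
      obtain ⟨p, q, h₁⟩ := foldl_mul_eq_mul (a i) (l := l.map a) (by simpa using hl')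
      obtain ⟨r, s, h₂⟩ := foldl_mul_eq_mul (a j) (l := m.map a) (by simpa using hm')
      rw [h₁, h₂, mul_mul_mul_eq_zero hB]

end MetabelianJordan

/-! ### The Grassmann algebra -/

variable (F) in
/-- The generators of the Grassmann algebra. -/
def gen (n : ℕ) : Grassmann F := ExteriorAlgebra.ι F (Finsupp.single n 1)

lemma gen_mem (n : ℕ) : gen F n ∈ grassmannPart F 1 :=
  CliffordAlgebra.ι_mem_evenOdd_one _ _

lemma one_mem_grassmannPart : (1 : Grassmann F) ∈ grassmannPart F 0 :=
  CliffordAlgebra.one_le_evenOdd_zero _ (Submodule.mem_one.2 ⟨1, map_one _⟩)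

lemma ι_mul_ι_swap (v w : ℕ →₀ F) : ExteriorAlgebra.ι F v * ExteriorAlgebra.ι F w
    = -(ExteriorAlgebra.ι F w * ExteriorAlgebra.ι F v) :=
  eq_neg_of_add_eq_zero_left (ExteriorAlgebra.ι_add_mul_swap v w)

lemma commute_of_mem_even {γ : Grassmann F} (hγ : γ ∈ grassmannPart F 0) (δ : Grassmann F) :
    γ * δ = δ * γ := by
  have h₁ : ∀ v : ℕ →₀ F, Commute γ (ExteriorAlgebra.ι F v) := by
    intro v
    induction γ, hγ using CliffordAlgebra.even_induction with
    | algebraMap r => exact Algebra.commute_algebraMap_left r _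
    | add x y hx hy ihx ihy => exact ihx.add_left ihy
    | ι_mul_ι_mul m₁ m₂ x hx ih =>
      refine Commute.mul_left ?_ ih
      change ExteriorAlgebra.ι F m₁ * ExteriorAlgebra.ι F m₂ * ExteriorAlgebra.ι F v
        = ExteriorAlgebra.ι F v * (ExteriorAlgebra.ι F m₁ * ExteriorAlgebra.ι F m₂)
      rw [mul_assoc, ι_mul_ι_swap m₂ v, mul_neg, ← mul_assoc, ι_mul_ι_swap m₁ v, neg_mul, neg_neg,
        mul_assoc]
  change Commute γ δ
  induction δ using CliffordAlgebra.induction with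
  | algebraMap r => exact Algebra.commute_algebraMap_right r _
  | ι v => exact h₁ v
  | mul x y hx hy => exact hx.mul_right hy
  | add x y hx hy => exact hx.add_right hy

lemma ι_mul_eq_neg_mul_ι {γ : Grassmann F} (hγ : γ ∈ grassmannPart F 1) (v : ℕ →₀ F) :
    ExteriorAlgebra.ι F v * γ = -(γ * ExteriorAlgebra.ι F v) := by
  induction γ, hγ using CliffordAlgebra.odd_induction with
  | ι w => exact ι_mul_ι_swap v w
  | add x y hx hy ihx ihy => rw [mul_add, ihx, ihy, add_mul, neg_add]
  | ι_mul_ι_mul m₁ m₂ x hx ih =>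
    have := commute_of_mem_even (CliffordAlgebra.ι_mul_ι_mem_evenOdd_zero
      (0 : QuadraticForm F (ℕ →₀ F)) m₁ m₂) (ExteriorAlgebra.ι F v)
    rw [← mul_assoc, ← this, mul_assoc, ih, mul_neg]
    simp only [mul_assoc]

lemma anticommute_of_mem_odd {γ δ : Grassmann F} (hγ : γ ∈ grassmannPart F 1)
    (hδ : δ ∈ grassmannPart F 1) : γ * δ = -(δ * γ) := by
  induction γ, hγ using CliffordAlgebra.odd_induction with
  | ι w => exact ι_mul_eq_neg_mul_ι hδ w
  | add x y hx hy ihx ihy => rw [add_mul, ihx, ihy, mul_add, neg_add]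
  | ι_mul_ι_mul m₁ m₂ x hx ih =>
    have := commute_of_mem_even (CliffordAlgebra.ι_mul_ι_mem_evenOdd_zero
      (0 : QuadraticForm F (ℕ →₀ F)) m₁ m₂) δ
    rw [mul_assoc, ih, mul_neg, ← mul_assoc, this, mul_assoc]

lemma contractLeft_gen_prod (n : ℕ) (l : List ℕ) (hl : n ∉ l) :
    CliffordAlgebra.contractLeft (Q := (0 : QuadraticForm F (ℕ →₀ F))) (Finsupp.lapply n)
      ((l.map (gen F)).prod) = 0 := by
  induction l with
  | nil => exact CliffordAlgebra.contractLeft_one _ _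
  | cons m l ih =>
    rw [List.mem_cons, not_or] at hl
    rw [List.map_cons, List.prod_cons]
    refine (CliffordAlgebra.contractLeft_ι_mul _ _ _).trans ?_
    rw [ih hl.2]
    simp [Ne.symm hl.1]

/-- Contraction with the coordinate functional of the first generator strips that generator off,
since it does not occur again. -/
lemma gen_prod_ne_zero {l : List ℕ} (hl : l.Nodup) : (l.map (gen F)).prod ≠ 0 := by
  induction l with
  | nil => simp
  | cons n l ih =>
    rw [List.nodup_cons] at hl
    intro h
    refine ih hl.2 ?_
    have h₁ : CliffordAlgebra.contractLeft (Q := (0 : QuadraticForm F (ℕ →₀ F)))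
        (Finsupp.lapply n) (gen F n * (l.map (gen F)).prod) = (l.map (gen F)).prod := by
      refine (CliffordAlgebra.contractLeft_ι_mul _ _ _).trans ?_
      rw [contractLeft_gen_prod n l hl.1]
      simp
    rw [← h₁, ← List.prod_cons, ← List.map_cons, h, map_zero]

/-! ### Homomorphisms -/

/-- The homomorphism from a quotient algebra induced by a homomorphism vanishing on the ideal. -/
def quotientLift {A : Type u} [NonUnitalNonAssocRing A] [Module F A] [IsScalarTower F A A]
    [SMulCommClass F A A] (I : Submodule F A) (hI : IsIdeal I) {B : NAAlgebra F}
    (φ : A →ₙₐ[F] B.carrier) (h : ∀ x ∈ I, φ x = 0) :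
    (quotientAlgebra I hI).carrier →ₙₐ[F] B.carrier :=
  let ψ : (quotientAlgebra I hI).carrier →ₗ[F] B.carrier := I.liftQ (φ : A →ₗ[F] B.carrier) h
  { toFun := ψ
    map_smul' := map_smul ψ
    map_zero' := map_zero ψ
    map_add' := map_add ψ
    map_mul' := fun x y => by
      obtain ⟨p, rfl⟩ := quotientMk_surjective I hI x
      obtain ⟨q, rfl⟩ := quotientMk_surjective I hI y
      rw [← quotientMk_mul]
      exact map_mul φ p q }

lemma quotientLift_mk {A : Type u} [NonUnitalNonAssocRing A] [Module F A] [IsScalarTower F A A]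
    [SMulCommClass F A A] (I : Submodule F A) (hI : IsIdeal I) {B : NAAlgebra F}
    (φ : A →ₙₐ[F] B.carrier) (h : ∀ x ∈ I, φ x = 0) (p : A) :
    quotientLift I hI φ h (quotientMk I hI p) = φ p :=
  rfl

lemma map_lift {A B : NAAlgebra F} (φ : A.carrier →ₙₐ[F] B.carrier) {X : Type} (a : X → A.carrier)
    (f : FreeNonUnitalNonAssocAlgebra F X) :
    φ (FreeNonUnitalNonAssocAlgebra.lift F a f)
      = FreeNonUnitalNonAssocAlgebra.lift F (fun n => φ (a n)) f := by
  have : φ.comp (FreeNonUnitalNonAssocAlgebra.lift F a)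
      = FreeNonUnitalNonAssocAlgebra.lift F (fun n => φ (a n)) :=
    FreeNonUnitalNonAssocAlgebra.hom_ext F fun n => by simp
  rw [← this]
  rfl

/-- Homomorphisms to members of the variety separate the points of the free algebra, and each of
them sends a value of `f` to a value of `f`, that is, to zero. -/
lemma freeAlgebra_mem (S : Set (Poly F)) (X : Type) : freeAlgebra (variety S) X ∈ variety S := by
  intro f hf a
  obtain ⟨p, hp⟩ := quotientMk_surjective _ (relations_isIdeal (variety S) X)
    (FreeNonUnitalNonAssocAlgebra.lift F a f)
  refine hp.symm.trans ((quotientMk_eq_zero _ _ _).2 fun B hB b => ?_)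
  have h := quotientLift_mk _ (relations_isIdeal (variety S) X)
    (FreeNonUnitalNonAssocAlgebra.lift F b) (fun x hx => hx B hB b) p
  rw [← h, hp]
  exact (map_lift (A := freeAlgebra (variety S) X) _ a f).trans (hB f hf _)

/-! ### Grassmann envelopes -/

/-- The inclusion of the Grassmann envelope into the tensor product. -/
def envelopeIncl (A : SuperAlgebra F) :
    (grassmannEnvelope A).carrier →ₙₐ[F] Grassmann F ⊗[F] A.carrier :=
  NonUnitalSubalgebraClass.subtype (envelopeSubalgebra A)

/-- An element of the Grassmann envelope. -/
def envelopeMk (A : SuperAlgebra F) (x : Grassmann F ⊗[F] A.carrier)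
    (hx : x ∈ envelopeSubspace A) : (grassmannEnvelope A).carrier :=
  (⟨x, hx⟩ : envelopeSubalgebra A)

lemma envelopeIncl_mk (A : SuperAlgebra F) (x : Grassmann F ⊗[F] A.carrier)
    (hx : x ∈ envelopeSubspace A) : envelopeIncl A (envelopeMk A x hx) = x :=
  rfl

lemma envelopeIncl_injective (A : SuperAlgebra F) : Function.Injective (envelopeIncl A) :=
  Subtype.val_injective

lemma envelopeIncl_mem (A : SuperAlgebra F) (x : (grassmannEnvelope A).carrier) :
    envelopeIncl A x ∈ envelopeSubspace A :=
  Subtype.prop (p := fun x => x ∈ envelopeSubspace A) x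

/-- The homomorphism `G ⊗ A → G ⊗ B` induced by a homomorphism `A → B`. -/
def tensorMap {A B : NAAlgebra F} (φ : A.carrier →ₙₐ[F] B.carrier) :
    Grassmann F ⊗[F] A.carrier →ₙₐ[F] Grassmann F ⊗[F] B.carrier :=
  let ψ := LinearMap.lTensor (Grassmann F) (φ : A.carrier →ₗ[F] B.carrier)
  { toFun := ψ
    map_smul' := map_smul ψ
    map_zero' := map_zero ψ
    map_add' := map_add ψ
    map_mul' := fun x y => by
      induction x using TensorProduct.induction_on with
      | zero => simp
      | add x x' hx hx' => rw [add_mul, map_add, hx, hx', map_add, add_mul]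
      | tmul g a =>
        induction y using TensorProduct.induction_on with
        | zero => simp
        | add y y' hy hy' => rw [mul_add, map_add, hy, hy', map_add, mul_add]
        | tmul h b => simp [ψ] }

lemma tensorMap_tmul {A B : NAAlgebra F} (φ : A.carrier →ₙₐ[F] B.carrier) (g : Grassmann F)
    (a : A.carrier) : tensorMap φ (g ⊗ₜ a) = g ⊗ₜ φ a :=
  rfl

lemma tensorMap_mem {A B : SuperAlgebra F} (φ : A.carrier →ₙₐ[F] B.carrier)
    (hφ : ∀ i, ∀ a ∈ A.part i, φ a ∈ B.part i) {x : Grassmann F ⊗[F] A.carrier}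
    (hx : x ∈ envelopeSubspace A) :
    tensorMap (A := A.toNAAlgebra) (B := B.toNAAlgebra) φ x ∈ envelopeSubspace B := by
  refine envelopeSubspace_induction A (P := fun x => tensorMap (A := A.toNAAlgebra)
    (B := B.toNAAlgebra) φ x ∈ envelopeSubspace B) ?_ ?_ ?_ hx
  · rw [map_zero]; exact zero_mem _
  · intro x y hx hy
    rw [map_add]; exact add_mem hx hy
  · intro i g a hg ha
    exact tmul_mem_envelopeSubspace B hg (hφ i a ha)

/-- The homomorphism of Grassmann envelopes induced by an even homomorphism of superalgebras. -/
def envelopeMap {A B : SuperAlgebra F} (φ : A.carrier →ₙₐ[F] B.carrier)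
    (hφ : ∀ i, ∀ a ∈ A.part i, φ a ∈ B.part i) :
    (grassmannEnvelope A).carrier →ₙₐ[F] (grassmannEnvelope B).carrier where
  toFun x := envelopeMk B _ (tensorMap_mem φ hφ (envelopeIncl_mem A x))
  map_smul' c x := envelopeIncl_injective B (by
    simp only [envelopeIncl_mk, map_smul, MonoidHom.id_apply])
  map_zero' := envelopeIncl_injective B (by simp only [envelopeIncl_mk, map_zero])
  map_add' x y := envelopeIncl_injective B (by simp only [envelopeIncl_mk, map_add])
  map_mul' x y := envelopeIncl_injective B (by simp only [envelopeIncl_mk, map_mul])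

lemma envelopeIncl_map {A B : SuperAlgebra F} (φ : A.carrier →ₙₐ[F] B.carrier)
    (hφ : ∀ i, ∀ a ∈ A.part i, φ a ∈ B.part i) (x : (grassmannEnvelope A).carrier) :
    envelopeIncl B (envelopeMap φ hφ x)
      = tensorMap (A := A.toNAAlgebra) (B := B.toNAAlgebra) φ (envelopeIncl A x) :=
  rfl

/-! ### Universal property of free superalgebras -/

section FreeSuper

variable {X : Type} (deg : X → ZMod 2) (V : Set (SuperAlgebra F))

/-- The homomorphism from the free superalgebra which extends a map of the generators. -/
def freeSuperLift {B : SuperAlgebra F} (hB : B ∈ V) (b : X → B.carrier)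
    (hb : ∀ x, b x ∈ B.part (deg x)) : (freeSuperAlgebra deg V).carrier →ₙₐ[F] B.carrier :=
  quotientLift _ (superRelations_isIdeal deg V) (FreeNonUnitalNonAssocAlgebra.lift F b)
    fun _ hx => hx B hB b hb

lemma freeSuperLift_mk {B : SuperAlgebra F} (hB : B ∈ V) (b : X → B.carrier)
    (hb : ∀ x, b x ∈ B.part (deg x)) (p : FreeNonUnitalNonAssocAlgebra F X) :
    freeSuperLift deg V hB b hb (quotientMk _ (superRelations_isIdeal deg V) p)
      = FreeNonUnitalNonAssocAlgebra.lift F b p :=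
  rfl

lemma freeSuperLift_mem_part {B : SuperAlgebra F} (hB : B ∈ V) (b : X → B.carrier)
    (hb : ∀ x, b x ∈ B.part (deg x)) (i : ZMod 2) (z : (freeSuperAlgebra deg V).carrier)
    (hz : z ∈ (freeSuperAlgebra deg V).part i) : freeSuperLift deg V hB b hb z ∈ B.part i := by
  obtain ⟨p, hp, rfl⟩ := hz
  rw [freeSuperLift_mk]
  exact lift_mem_part deg B hb hp

lemma eq_zero_of_freeSuperLift (z : (freeSuperAlgebra deg V).carrier)
    (h : ∀ (B : SuperAlgebra F) (hB : B ∈ V) (b : X → B.carrier)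
      (hb : ∀ x, b x ∈ B.part (deg x)), freeSuperLift deg V hB b hb z = 0) : z = 0 := by
  obtain ⟨p, rfl⟩ := quotientMk_surjective _ (superRelations_isIdeal deg V) z
  exact (quotientMk_eq_zero _ _ _).2 fun B hB b hb => h B hB b hb

/-- Expanding along a basis of the Grassmann algebra reduces this to the coefficients in the free
superalgebra, where homomorphisms separate points. -/
lemma eq_zero_of_tensorMap_freeSuperLift (z : Grassmann F ⊗[F] (freeSuperAlgebra deg V).carrier)
    (h : ∀ (B : SuperAlgebra F) (hB : B ∈ V) (b : X → B.carrier)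
      (hb : ∀ x, b x ∈ B.part (deg x)),
      tensorMap (A := (freeSuperAlgebra deg V).toNAAlgebra) (B := B.toNAAlgebra)
        (freeSuperLift deg V hB b hb) z = 0) : z = 0 := by
  classical
  let 𝓑 := Module.Basis.ofVectorSpace F (Grassmann F)
  refine (EmbeddingLike.map_eq_zero_iff (f := TensorProduct.equivFinsuppOfBasisLeft 𝓑)).1 ?_
  ext k
  refine eq_zero_of_freeSuperLift deg V _ fun B hB b hb => ?_
  have key : ∀ z : Grassmann F ⊗[F] (freeSuperAlgebra deg V).carrier,
      freeSuperLift deg V hB b hb (TensorProduct.equivFinsuppOfBasisLeft 𝓑 z k)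
      = TensorProduct.equivFinsuppOfBasisLeft 𝓑
        (tensorMap (A := (freeSuperAlgebra deg V).toNAAlgebra) (B := B.toNAAlgebra)
          (freeSuperLift deg V hB b hb) z) k := by
    intro z
    induction z using TensorProduct.induction_on with
    | zero => simp
    | add x y hx hy => simp only [map_add, Finsupp.add_apply, hx, hy]
    | tmul g a => simp [tensorMap_tmul]
  rw [key, h B hB b hb]
  simp

lemma freeSuperAlgebra_mem (S : Set (Poly F)) :
    freeSuperAlgebra deg (superVariety (variety S)) ∈ superVariety (variety S) := by
  intro f hf a
  refine envelopeIncl_injective _ ?_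
  rw [map_zero]
  refine eq_zero_of_tensorMap_freeSuperLift deg _ _ fun B hB b hb => ?_
  rw [← envelopeIncl_map _ (freeSuperLift_mem_part deg _ hB b hb), map_lift]
  exact (congrArg _ (hB f hf _)).trans (map_zero _)

end FreeSuper

/-! ### A metabelian Jordan superalgebra generated by two odd elements -/

/-- The basis `x, y, m₀, m₁, m₂, …` of the zigzag superalgebra. -/
inductive ZigzagBasis : Type
  | x : ZigzagBasis
  | y : ZigzagBasis
  | m (k : ℕ) : ZigzagBasis

/-- The parities of the basis elements: `x` and `y` are odd, `mₖ` has the parity of `k`. -/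
def ZigzagBasis.parity : ZigzagBasis → ZMod 2
  | .x => 1
  | .y => 1
  | .m k => k

variable (F) in
/-- The underlying space of the zigzag superalgebra. -/
def ZigzagSpace : Type u := ZigzagBasis →₀ F

instance : AddCommGroup (ZigzagSpace F) := inferInstanceAs (AddCommGroup (ZigzagBasis →₀ F))

instance : Module F (ZigzagSpace F) := inferInstanceAs (Module F (ZigzagBasis →₀ F))

variable (F) in
/-- The basis elements of the zigzag superalgebra. -/
def zigzagBasis (b : ZigzagBasis) : ZigzagSpace F := Finsupp.single b (1 : F)

variable (F) in
/-- The multiplication table: `x y = - y x = m₀`, `m₂ₖ x = x m₂ₖ = m₂ₖ₊₁`,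
`m₂ₖ₊₁ y = - y m₂ₖ₊₁ = m₂ₖ₊₂`, and all other products vanish. -/
def zigzagTable : ZigzagBasis → ZigzagBasis → ZigzagSpace F
  | .x, .y => zigzagBasis F (.m 0)
  | .y, .x => -zigzagBasis F (.m 0)
  | .m k, .x => if Even k then zigzagBasis F (.m (k + 1)) else 0
  | .x, .m k => if Even k then zigzagBasis F (.m (k + 1)) else 0
  | .m k, .y => if Even k then 0 else zigzagBasis F (.m (k + 1))
  | .y, .m k => if Even k then 0 else -zigzagBasis F (.m (k + 1))
  | _, _ => 0

variable (F) in
/-- The multiplication of the zigzag superalgebra. -/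
def zigzagMul : ZigzagSpace F →ₗ[F] ZigzagSpace F →ₗ[F] ZigzagSpace F :=
  Finsupp.linearCombination F fun b =>
    (Finsupp.linearCombination F (zigzagTable F b) : (ZigzagBasis →₀ F) →ₗ[F] ZigzagSpace F)

instance : NonUnitalNonAssocRing (ZigzagSpace F) :=
  { (inferInstance : AddCommGroup (ZigzagSpace F)) with
    mul := fun p q => zigzagMul F p q
    left_distrib := fun p q t => map_add (zigzagMul F p) q t
    right_distrib := fun p q t => LinearMap.map_add₂ (zigzagMul F) p q t
    zero_mul := fun p => LinearMap.map_zero₂ (zigzagMul F) p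
    mul_zero := fun p => map_zero (zigzagMul F p) }

instance : IsScalarTower F (ZigzagSpace F) (ZigzagSpace F) :=
  ⟨fun c p q => LinearMap.map_smul₂ (zigzagMul F) c p q⟩

instance : SMulCommClass F (ZigzagSpace F) (ZigzagSpace F) :=
  ⟨fun c p q => (map_smul (zigzagMul F p) c q).symm⟩

lemma zigzagBasis_mul (b c : ZigzagBasis) :
    zigzagBasis F b * zigzagBasis F c = zigzagTable F b c := by
  change zigzagMul F _ _ = _
  simp only [zigzagMul, zigzagBasis]
  erw [Finsupp.linearCombination_single, one_smul, Finsupp.linearCombination_single, one_smul]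

variable (F) in
/-- The homogeneous components of the zigzag superalgebra. -/
def zigzagPart (i : ZMod 2) : Submodule F (ZigzagSpace F) :=
  (Finsupp.supported F F {b | ZigzagBasis.parity b = i} : Submodule F (ZigzagBasis →₀ F))

lemma zigzagPart_eq_span (i : ZMod 2) :
    zigzagPart F i = Submodule.span F (zigzagBasis F '' {b | b.parity = i}) :=
  Finsupp.supported_eq_span_single F _

lemma zigzagBasis_mem_part (b : ZigzagBasis) : zigzagBasis F b ∈ zigzagPart F b.parity := by
  rw [zigzagPart_eq_span]
  exact Submodule.subset_span ⟨b, rfl, rfl⟩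

lemma zigzagTable_mem_part (b c : ZigzagBasis) :
    zigzagTable F b c ∈ zigzagPart F (b.parity + c.parity) := by
  have h : ∀ (k : ℕ) (i : ZMod 2), (k : ZMod 2) = i →
      zigzagBasis F (.m k) ∈ zigzagPart F i := by
    rintro k i rfl
    exact zigzagBasis_mem_part (.m k)
  cases b <;> cases c <;> simp only [zigzagTable, ZigzagBasis.parity] <;>
    (try split_ifs) <;> first
      | exact zero_mem _
      | exact h _ _ (by decide)
      | exact neg_mem (h _ _ (by decide))
      | exact h _ _ (by rw [Nat.cast_add, Nat.cast_one, add_comm])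
      | exact h _ _ (by rw [Nat.cast_add, Nat.cast_one])
      | exact neg_mem (h _ _ (by rw [Nat.cast_add, Nat.cast_one, add_comm]))

variable (F) in
/-- The zigzag superalgebra. -/
def zigzagAlgebra : SuperAlgebra F where
  carrier := ZigzagSpace F
  part := zigzagPart F
  isCompl := by
    refine ⟨Finsupp.disjoint_supported_supported (M := F) (R := F) ?_,
      Finsupp.codisjoint_supported_supported (M := F) (R := F) ?_⟩
    · rw [Set.disjoint_left]
      intro b h₀ h₁
      have : (0 : ZMod 2) = 1 := h₀.symm.trans h₁
      exact absurd this (by decide)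
    · rw [codisjoint_iff_le_sup]
      intro b _
      have h2 : ∀ i : ZMod 2, i = 0 ∨ i = 1 := by decide
      exact h2 b.parity
  mul_mem := by
    intro i j a b ha hb
    rw [zigzagPart_eq_span] at ha hb
    induction ha using Submodule.span_induction with
    | zero => rw [zero_mul]; exact zero_mem _
    | add a a' _ _ h h' => rw [add_mul]; exact add_mem h h'
    | smul c a _ h => rw [smul_mul_assoc]; exact Submodule.smul_mem _ _ h
    | mem a ha =>
      obtain ⟨a, rfl, rfl⟩ := ha
      induction hb using Submodule.span_induction with
      | zero => rw [mul_zero]; exact zero_mem _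
      | add b b' _ _ h h' => rw [mul_add]; exact add_mem h h'
      | smul c b _ h => rw [mul_smul_comm]; exact Submodule.smul_mem _ _ h
      | mem b hb =>
        obtain ⟨b, rfl, rfl⟩ := hb
        rw [zigzagBasis_mul]
        exact zigzagTable_mem_part a b

/-- The homogeneous tensor `γ ⊗ b` with a basis element `b`. -/
def zigzagTensor (γ : Grassmann F) (b : ZigzagBasis) : Grassmann F ⊗[F] ZigzagSpace F :=
  γ ⊗ₜ zigzagBasis F b

lemma zigzagTensor_mem {γ : Grassmann F} {b : ZigzagBasis} (h : γ ∈ grassmannPart F b.parity) :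
    zigzagTensor γ b ∈ envelopeSubspace (zigzagAlgebra F) :=
  tmul_mem_envelopeSubspace (zigzagAlgebra F) h (zigzagBasis_mem_part b)

lemma zigzagEnvelope_induction {P : Grassmann F ⊗[F] ZigzagSpace F → Prop} (h0 : P 0)
    (hadd : ∀ x y, P x → P y → P (x + y))
    (ht : ∀ (γ : Grassmann F) (b : ZigzagBasis), γ ∈ grassmannPart F b.parity →
      P (zigzagTensor γ b)) {x : Grassmann F ⊗[F] ZigzagSpace F}
    (hx : x ∈ envelopeSubspace (zigzagAlgebra F)) : P x := by
  have key : ∀ i : ZMod 2, ∀ a ∈ zigzagPart F i, ∀ g ∈ grassmannPart F i, P (g ⊗ₜ[F] a) := by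
    intro i a ha
    rw [zigzagPart_eq_span] at ha
    induction ha using Submodule.span_induction with
    | zero => intro g _; rw [TensorProduct.tmul_zero]; exact h0
    | add a a' _ _ h h' =>
      intro g hg; rw [TensorProduct.tmul_add]; exact hadd _ _ (h g hg) (h' g hg)
    | smul c a _ h =>
      intro g hg
      rw [← TensorProduct.smul_tmul]
      exact h _ (Submodule.smul_mem _ c hg)
    | mem a ha =>
      obtain ⟨b, rfl, rfl⟩ := ha
      exact fun g hg => ht g b hg
  exact envelopeSubspace_induction (zigzagAlgebra F) h0 hadd
    (fun i g a hg ha => key i a ha g hg) hx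

lemma zigzagTensor_mul (γ δ : Grassmann F) (b c : ZigzagBasis) :
    zigzagTensor γ b * zigzagTensor δ c = (γ * δ) ⊗ₜ[F] zigzagTable F b c := by
  rw [zigzagTensor, zigzagTensor, Algebra.TensorProduct.tmul_mul_tmul, zigzagBasis_mul]

lemma zigzagTensor_x_mul_y (γ δ : Grassmann F) :
    zigzagTensor γ .x * zigzagTensor δ .y = zigzagTensor (γ * δ) (.m 0) :=
  zigzagTensor_mul γ δ .x .y

lemma zigzagTensor_y_mul_x (γ δ : Grassmann F) :
    zigzagTensor γ .y * zigzagTensor δ .x = zigzagTensor (-(γ * δ)) (.m 0) := by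
  rw [zigzagTensor_mul, zigzagTable, TensorProduct.tmul_neg, ← TensorProduct.neg_tmul,
    zigzagTensor]

lemma zigzagTensor_m_mul_x (γ δ : Grassmann F) (k : ℕ) :
    zigzagTensor γ (.m k) * zigzagTensor δ .x
      = if Even k then zigzagTensor (γ * δ) (.m (k + 1)) else 0 := by
  rw [zigzagTensor_mul, zigzagTable]
  split_ifs <;> simp [zigzagTensor]

lemma zigzagTensor_m_mul_y (γ δ : Grassmann F) (k : ℕ) :
    zigzagTensor γ (.m k) * zigzagTensor δ .y
      = if Even k then 0 else zigzagTensor (γ * δ) (.m (k + 1)) := by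
  rw [zigzagTensor_mul, zigzagTable]
  split_ifs <;> simp [zigzagTensor]

lemma zigzagTensor_x_mul_m (γ δ : Grassmann F) (k : ℕ) :
    zigzagTensor γ .x * zigzagTensor δ (.m k)
      = if Even k then zigzagTensor (γ * δ) (.m (k + 1)) else 0 := by
  rw [zigzagTensor_mul, zigzagTable]
  split_ifs <;> simp [zigzagTensor]

lemma zigzagTensor_y_mul_m (γ δ : Grassmann F) (k : ℕ) :
    zigzagTensor γ .y * zigzagTensor δ (.m k)
      = if Even k then 0 else zigzagTensor (-(γ * δ)) (.m (k + 1)) := by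
  rw [zigzagTensor_mul, zigzagTable]
  split_ifs
  · simp
  · rw [TensorProduct.tmul_neg, ← TensorProduct.neg_tmul, zigzagTensor]

lemma zigzagTensor_m_mul_m (γ δ : Grassmann F) (k l : ℕ) :
    zigzagTensor γ (.m k) * zigzagTensor δ (.m l) = 0 := by
  rw [zigzagTensor_mul, zigzagTable, TensorProduct.tmul_zero] <;> simp

lemma zigzagTensor_x_mul_x (γ δ : Grassmann F) :
    zigzagTensor γ .x * zigzagTensor δ .x = 0 := by
  rw [zigzagTensor_mul, zigzagTable, TensorProduct.tmul_zero] <;> simp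

lemma zigzagTensor_y_mul_y (γ δ : Grassmann F) :
    zigzagTensor γ .y * zigzagTensor δ .y = 0 := by
  rw [zigzagTensor_mul, zigzagTable, TensorProduct.tmul_zero] <;> simp

lemma zigzagTensor_neg (γ : Grassmann F) (b : ZigzagBasis) :
    zigzagTensor (-γ) b = -zigzagTensor γ b :=
  TensorProduct.neg_tmul _ _

lemma zigzagTensor_zero (b : ZigzagBasis) : zigzagTensor (0 : Grassmann F) b = 0 :=
  TensorProduct.zero_tmul _ _

/-- The signs in `zigzagTable` are those produced by interchanging Grassmann coefficients: a minus
precisely when both factors are odd. -/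
lemma zigzag_mul_comm {z z' : Grassmann F ⊗[F] ZigzagSpace F}
    (hz : z ∈ envelopeSubspace (zigzagAlgebra F))
    (hz' : z' ∈ envelopeSubspace (zigzagAlgebra F)) : z * z' = z' * z := by
  refine zigzagEnvelope_induction (P := fun z => z * z' = z' * z) (by simp)
    (fun a b ha hb => by rw [add_mul, mul_add, ha, hb]) (fun γ b hγ => ?_) hz
  refine zigzagEnvelope_induction (P := fun z' => zigzagTensor γ b * z' = z' * zigzagTensor γ b)
    (by simp) (fun a b ha hb => by rw [add_mul, mul_add, ha, hb]) (fun δ c hδ => ?_) hz'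
  have h₀ : ∀ k : ℕ, Even k → ((k : ℕ) : ZMod 2) = 0 := fun k hk =>
    (ZMod.natCast_eq_zero_iff_even).2 hk
  have h₁ : ∀ k : ℕ, ¬Even k → ((k : ℕ) : ZMod 2) = 1 := fun k hk =>
    (ZMod.natCast_eq_one_iff_odd).2 (Nat.not_even_iff_odd.1 hk)
  rcases b with - | - | k <;> rcases c with - | - | l <;>
    simp only [ZigzagBasis.parity] at hγ hδ <;>
    simp only [zigzagTensor_x_mul_x, zigzagTensor_y_mul_y, zigzagTensor_m_mul_m,
      zigzagTensor_x_mul_y, zigzagTensor_y_mul_x, zigzagTensor_m_mul_x, zigzagTensor_m_mul_y,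
      zigzagTensor_x_mul_m, zigzagTensor_y_mul_m]
  · rw [anticommute_of_mem_odd hγ hδ]
  · split_ifs with hl
    · rw [commute_of_mem_even (h₀ l hl ▸ hδ) γ]
    · rfl
  · rw [anticommute_of_mem_odd hγ hδ, neg_neg]
  · split_ifs with hl
    · rfl
    · rw [anticommute_of_mem_odd hγ (h₁ l hl ▸ hδ), neg_neg]
  · split_ifs with hk
    · rw [commute_of_mem_even (h₀ k hk ▸ hγ) δ]
    · rfl
  · split_ifs with hk
    · rfl
    · rw [anticommute_of_mem_odd (h₁ k hk ▸ hγ) hδ]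

/-- Products land on the `m k`, whose mutual products vanish; this is the source of metabelianity. A
zero product is covered by `ε = 0`. -/
lemma exists_zigzagTensor_mul (γ δ : Grassmann F) (b c : ZigzagBasis) :
    ∃ (ε : Grassmann F) (k : ℕ), zigzagTensor γ b * zigzagTensor δ c = zigzagTensor ε (.m k) := by
  have h₀ : ∃ (ε : Grassmann F) (k : ℕ), 0 = zigzagTensor ε (.m k) :=
    ⟨0, 0, (zigzagTensor_zero _).symm⟩
  rcases b with - | - | k <;> rcases c with - | - | l <;>
    simp only [zigzagTensor_x_mul_x, zigzagTensor_y_mul_y, zigzagTensor_m_mul_m,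
      zigzagTensor_x_mul_y, zigzagTensor_y_mul_x, zigzagTensor_m_mul_x, zigzagTensor_m_mul_y,
      zigzagTensor_x_mul_m, zigzagTensor_y_mul_m] <;>
    (try split_ifs) <;> first
      | exact h₀
      | exact ⟨_, _, rfl⟩

lemma zigzag_mul_mul_mul {a b c d : Grassmann F ⊗[F] ZigzagSpace F}
    (ha : a ∈ envelopeSubspace (zigzagAlgebra F)) (hb : b ∈ envelopeSubspace (zigzagAlgebra F))
    (hc : c ∈ envelopeSubspace (zigzagAlgebra F)) (hd : d ∈ envelopeSubspace (zigzagAlgebra F)) :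
    (a * b) * (c * d) = 0 := by
  refine zigzagEnvelope_induction (P := fun a => (a * b) * (c * d) = 0) (by simp)
    (fun x y hx hy => by rw [add_mul, add_mul, hx, hy, add_zero]) (fun γ₁ b₁ _ => ?_) ha
  refine zigzagEnvelope_induction (P := fun b => (_ * b) * (c * d) = 0) (by simp)
    (fun x y hx hy => by rw [mul_add, add_mul, hx, hy, add_zero]) (fun γ₂ b₂ _ => ?_) hb
  refine zigzagEnvelope_induction (P := fun c => (_ * _) * (c * d) = 0) (by simp)
    (fun x y hx hy => by rw [add_mul, mul_add, hx, hy, add_zero]) (fun γ₃ b₃ _ => ?_) hc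
  refine zigzagEnvelope_induction (P := fun d => (_ * _) * (_ * d) = 0) (by simp)
    (fun x y hx hy => by rw [mul_add, mul_add, hx, hy, add_zero]) (fun γ₄ b₄ _ => ?_) hd
  obtain ⟨ε, k, h⟩ := exists_zigzagTensor_mul γ₁ γ₂ b₁ b₂
  obtain ⟨ε', k', h'⟩ := exists_zigzagTensor_mul γ₃ γ₄ b₃ b₄
  rw [h, h', zigzagTensor_m_mul_m]

/-- Reversing three anticommuting factors is an odd permutation. -/
lemma mul_mul_reverse {γ₁ γ₂ γ₃ : Grassmann F} (h₁ : γ₁ ∈ grassmannPart F 1)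
    (h₂ : γ₂ ∈ grassmannPart F 1) (h₃ : γ₃ ∈ grassmannPart F 1) (γ : Grassmann F) :
    γ * γ₁ * γ₂ * γ₃ = -(γ * γ₃ * γ₂ * γ₁) := by
  have : γ₁ * γ₂ * γ₃ = -(γ₃ * γ₂ * γ₁) := by
    rw [anticommute_of_mem_odd h₁ h₂, neg_mul, mul_assoc, anticommute_of_mem_odd h₁ h₃, mul_neg,
      neg_neg, ← mul_assoc, anticommute_of_mem_odd h₂ h₃, neg_mul]
  simp only [mul_assoc] at this ⊢
  rw [this, mul_neg]

/-- Only the patterns `x, y, x` for even `k` and `y, x, y` for odd `k` survive. Both are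
palindromic, so the sign comes entirely from the Grassmann coefficients. -/
lemma zigzag_mul_skew (γ : Grassmann F) (k : ℕ) {γ₁ γ₂ γ₃ : Grassmann F} {b₁ b₂ b₃ : ZigzagBasis}
    (h₁ : γ₁ ∈ grassmannPart F b₁.parity) (h₂ : γ₂ ∈ grassmannPart F b₂.parity)
    (h₃ : γ₃ ∈ grassmannPart F b₃.parity) :
    zigzagTensor γ (.m k) * zigzagTensor γ₁ b₁ * zigzagTensor γ₂ b₂ * zigzagTensor γ₃ b₃
      = -(zigzagTensor γ (.m k) * zigzagTensor γ₃ b₃ * zigzagTensor γ₂ b₂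
        * zigzagTensor γ₁ b₁) := by
  have hr : b₁.parity = 1 → b₂.parity = 1 → b₃.parity = 1 →
      γ * γ₁ * γ₂ * γ₃ = -(γ * γ₃ * γ₂ * γ₁) := fun e₁ e₂ e₃ =>
    mul_mul_reverse (e₁ ▸ h₁) (e₂ ▸ h₂) (e₃ ▸ h₃) γ
  by_cases hk : Even k <;> rcases b₁ with - | - | k₁ <;> rcases b₂ with - | - | k₂ <;>
    rcases b₃ with - | - | k₃ <;>
    simp [zigzagTensor_m_mul_x, zigzagTensor_m_mul_y, zigzagTensor_m_mul_m, hk,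
      Nat.even_add_one]
  · rw [hr rfl rfl rfl, zigzagTensor_neg]
  · rw [hr rfl rfl rfl, zigzagTensor_neg]

lemma zigzag_jordanForm_m {γ₁ γ₂ γ₃ γ₄ : Grassmann F} {b₂ b₃ b₄ : ZigzagBasis} (k : ℕ)
    (h₂ : γ₂ ∈ grassmannPart F b₂.parity)
    (h₃ : γ₃ ∈ grassmannPart F b₃.parity) (h₄ : γ₄ ∈ grassmannPart F b₄.parity) :
    jordanForm (zigzagTensor γ₁ (.m k)) (zigzagTensor γ₂ b₂) (zigzagTensor γ₃ b₃)
      (zigzagTensor γ₄ b₄) = 0 := by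
  rw [jordanForm, zigzag_mul_skew γ₁ k h₂ h₄ h₃, neg_add_cancel, zero_add]
  obtain ⟨ε, l, h⟩ := exists_zigzagTensor_mul γ₂ γ₃ b₂ b₃
  obtain ⟨ε', l', h'⟩ := exists_zigzagTensor_mul ε γ₄ (.m l) b₄
  rw [h, h', zigzagTensor_m_mul_m]

lemma jordanForm_swap_left {R : Type*} [NonUnitalNonAssocRing R] {x y : R} (h : x * y = y * x)
    (z t : R) : jordanForm x y z t = jordanForm y x z t := by
  rw [jordanForm, jordanForm, h]
  abel

lemma jordanForm_swap_right {R : Type*} [NonUnitalNonAssocRing R] {y z : R} (h : y * z = z * y)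
    (x t : R) : jordanForm x y z t = jordanForm x z y t := by
  rw [jordanForm, jordanForm, h]
  abel

lemma zigzag_jordanForm_tensor {γ₁ γ₂ γ₃ γ₄ : Grassmann F} {b₁ b₂ b₃ b₄ : ZigzagBasis}
    (h₁ : γ₁ ∈ grassmannPart F b₁.parity) (h₂ : γ₂ ∈ grassmannPart F b₂.parity)
    (h₃ : γ₃ ∈ grassmannPart F b₃.parity) (h₄ : γ₄ ∈ grassmannPart F b₄.parity) :
    jordanForm (zigzagTensor γ₁ b₁) (zigzagTensor γ₂ b₂) (zigzagTensor γ₃ b₃)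
      (zigzagTensor γ₄ b₄) = 0 := by
  have c₁₂ := zigzag_mul_comm (zigzagTensor_mem h₁) (zigzagTensor_mem h₂)
  have c₁₃ := zigzag_mul_comm (zigzagTensor_mem h₁) (zigzagTensor_mem h₃)
  have c₂₃ := zigzag_mul_comm (zigzagTensor_mem h₂) (zigzagTensor_mem h₃)
  -- The two orders of the four odd factors differ by an even permutation.
  have hr : ∀ {δ₁ δ₂ δ₃ δ₄ : Grassmann F}, δ₁ ∈ grassmannPart F 1 → δ₂ ∈ grassmannPart F 1 →
      δ₃ ∈ grassmannPart F 1 → δ₄ ∈ grassmannPart F 1 → δ₁ * δ₂ * δ₄ * δ₃ = δ₂ * δ₃ * δ₄ * δ₁ := by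
    intro δ₁ δ₂ δ₃ δ₄ e₁ e₂ e₃ e₄
    rw [mul_mul_reverse e₂ e₄ e₃ δ₁, anticommute_of_mem_odd e₁ e₃, neg_mul, neg_mul, neg_neg,
      mul_mul_reverse e₁ e₄ e₂ δ₃, anticommute_of_mem_odd e₃ e₂]
    simp only [neg_mul, neg_neg]
  rcases b₁ with - | - | k₁
  case m => exact zigzag_jordanForm_m k₁ h₂ h₃ h₄
  all_goals rcases b₂ with - | - | k₂
  case x.m => rw [jordanForm_swap_left c₁₂]; exact zigzag_jordanForm_m k₂ h₁ h₃ h₄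
  case y.m => rw [jordanForm_swap_left c₁₂]; exact zigzag_jordanForm_m k₂ h₁ h₃ h₄
  all_goals rcases b₃ with - | - | k₃
  case x.x.m =>
    rw [jordanForm_swap_right c₂₃, jordanForm_swap_left c₁₃]; exact zigzag_jordanForm_m k₃ h₁ h₂ h₄
  case x.y.m =>
    rw [jordanForm_swap_right c₂₃, jordanForm_swap_left c₁₃]; exact zigzag_jordanForm_m k₃ h₁ h₂ h₄
  case y.x.m =>
    rw [jordanForm_swap_right c₂₃, jordanForm_swap_left c₁₃]; exact zigzag_jordanForm_m k₃ h₁ h₂ h₄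
  case y.y.m =>
    rw [jordanForm_swap_right c₂₃, jordanForm_swap_left c₁₃]; exact zigzag_jordanForm_m k₃ h₁ h₂ h₄
  -- After `m₀` only `x` and then `y` can follow, so `b₄` must be `x` and the other three must be
  -- one `x` and two `y`'s; the three positions of that `x` are the goals left.
  all_goals rcases b₄ with - | - | k₄ <;>
    simp [jordanForm, zigzagTensor_x_mul_x, zigzagTensor_y_mul_y, zigzagTensor_m_mul_m,
      zigzagTensor_x_mul_y, zigzagTensor_y_mul_x, zigzagTensor_m_mul_x, zigzagTensor_m_mul_y]
  · rw [mul_mul_reverse h₂ h₄ h₃ γ₁, zigzagTensor_neg, neg_add_cancel]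
  · rw [hr h₁ h₂ h₃ h₄, zigzagTensor_neg, neg_add_cancel]
  · rw [anticommute_of_mem_odd h₁ h₃, anticommute_of_mem_odd h₂ h₃]
    simp only [neg_mul, neg_neg]
    rw [mul_mul_reverse h₁ h₄ h₂ γ₃, zigzagTensor_neg, neg_add_cancel]

variable (F) in
lemma zigzagAlgebra_mem [CharZero F] :
    zigzagAlgebra F ∈ superVariety (metabelianJordan F) := by
  refine (mem_metabelianJordan_iff _).2 ⟨fun a b => envelopeIncl_injective _ ?_,
    fun a b c d => envelopeIncl_injective _ ?_, fun x y z t => envelopeIncl_injective _ ?_⟩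
  · rw [map_mul, map_mul]
    exact zigzag_mul_comm (envelopeIncl_mem _ a) (envelopeIncl_mem _ b)
  · rw [map_mul, map_mul, map_mul, map_zero]
    exact zigzag_mul_mul_mul (envelopeIncl_mem _ a) (envelopeIncl_mem _ b)
      (envelopeIncl_mem _ c) (envelopeIncl_mem _ d)
  · have h : ∀ x y z t : Grassmann F ⊗[F] ZigzagSpace F,
        x ∈ envelopeSubspace (zigzagAlgebra F) → y ∈ envelopeSubspace (zigzagAlgebra F) →
        z ∈ envelopeSubspace (zigzagAlgebra F) → t ∈ envelopeSubspace (zigzagAlgebra F) →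
        jordanForm x y z t = 0 := by
      intro x y z t hx hy hz ht
      refine zigzagEnvelope_induction (P := fun x => jordanForm x y z t = 0) (by simp [jordanForm])
        (fun a b ha hb => ?_) (fun γ₁ b₁ h₁ => ?_) hx
      · refine Eq.trans ?_ ((congrArg₂ (· + ·) ha hb).trans (add_zero 0))
        simp only [jordanForm, add_mul, mul_add]
        abel
      refine zigzagEnvelope_induction (P := fun y => jordanForm _ y z t = 0) (by simp [jordanForm])
        (fun a b ha hb => ?_) (fun γ₂ b₂ h₂ => ?_) hy
      · refine Eq.trans ?_ ((congrArg₂ (· + ·) ha hb).trans (add_zero 0))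
        simp only [jordanForm, add_mul, mul_add]
        abel
      refine zigzagEnvelope_induction (P := fun z => jordanForm _ _ z t = 0) (by simp [jordanForm])
        (fun a b ha hb => ?_) (fun γ₃ b₃ h₃ => ?_) hz
      · refine Eq.trans ?_ ((congrArg₂ (· + ·) ha hb).trans (add_zero 0))
        simp only [jordanForm, add_mul, mul_add]
        abel
      refine zigzagEnvelope_induction (P := fun t => jordanForm _ _ _ t = 0) (by simp [jordanForm])
        (fun a b ha hb => ?_) (fun γ₄ b₄ h₄ => ?_) ht
      · refine Eq.trans ?_ ((congrArg₂ (· + ·) ha hb).trans (add_zero 0))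
        simp only [jordanForm, add_mul, mul_add]
        abel
      exact zigzag_jordanForm_tensor h₁ h₂ h₃ h₄
    have e : envelopeIncl (zigzagAlgebra F) (jordanForm x y z t)
        = jordanForm (envelopeIncl _ x) (envelopeIncl _ y) (envelopeIncl _ z)
          (envelopeIncl _ t) := by
      simp only [jordanForm, map_add, map_mul]
    rw [e, map_zero]
    exact h _ _ _ _ (envelopeIncl_mem _ x) (envelopeIncl_mem _ y) (envelopeIncl_mem _ z)
      (envelopeIncl_mem _ t)

/-! ### Words in the Grassmann envelope of the zigzag superalgebra -/

lemma zigzagTensor_smul (c : F) (γ : Grassmann F) (b : ZigzagBasis) :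
    zigzagTensor (c • γ) b = c • zigzagTensor γ b :=
  (TensorProduct.smul_tmul' _ _ _).symm

lemma eq_zero_or_eq_zero_of_tmul {M N : Type*} [AddCommGroup M] [Module F M] [AddCommGroup N]
    [Module F N] {g : M} {b : N} (h : g ⊗ₜ[F] b = 0) : g = 0 ∨ b = 0 := by
  classical
  let 𝓑 := Module.Basis.ofVectorSpace F M
  by_cases hb : b = 0
  · exact Or.inr hb
  · refine Or.inl (𝓑.ext_elem fun i => ?_)
    have h₁ := TensorProduct.equivFinsuppOfBasisLeft_apply_tmul_apply 𝓑 g b i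
    rw [h, map_zero, Finsupp.zero_apply] at h₁
    rw [map_zero, Finsupp.zero_apply]
    exact (smul_eq_zero.1 h₁.symm).resolve_right hb

lemma zigzagTensor_eq_zero {γ : Grassmann F} {b : ZigzagBasis} (h : zigzagTensor γ b = 0) :
    γ = 0 := by
  have hb : zigzagBasis F b ≠ 0 := Finsupp.single_ne_zero.2 one_ne_zero
  exact (eq_zero_or_eq_zero_of_tmul h).resolve_right hb

lemma foldl_zero {R : Type*} [NonUnitalNonAssocRing R] (l : List R) :
    l.foldl (· * ·) 0 = 0 := by
  induction l with
  | nil => rfl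
  | cons a l ih => rw [List.foldl_cons, zero_mul, ih]

lemma map_foldl {R S : Type*} [NonUnitalNonAssocRing R] [NonUnitalNonAssocRing S] [Module F R]
    [Module F S] (φ : R →ₙₐ[F] S) {ι : Type*} (a : ι → R) (l : List ι) (w : R) :
    φ ((l.map a).foldl (· * ·) w) = (l.map fun i => φ (a i)).foldl (· * ·) (φ w) := by
  induction l generalizing w with
  | nil => rfl
  | cons i l ih => rw [List.map_cons, List.foldl_cons, ih, map_mul]; rfl

/-- The entries of the list in odd positions belong to `T₀`, those in even positions do not. -/
def IsPattern (T₀ : Finset ℕ) (l : List ℕ) : Prop :=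
  (∀ j ∈ (splitList l).1, j ∈ T₀) ∧ ∀ j ∈ (splitList l).2, j ∉ T₀

open scoped Classical in
/-- The product of the Grassmann generators along a list, if the list matches the pattern. -/
def patternProd (T₀ : Finset ℕ) (l : List ℕ) : Grassmann F :=
  if IsPattern T₀ l then (l.map (gen F)).prod else 0

/-- The homogeneous elements substituted for the variables. -/
def zigzagLetter (T₀ : Finset ℕ) (j : ℕ) : Grassmann F ⊗[F] ZigzagSpace F :=
  zigzagTensor (gen F j) (if j ∈ T₀ then .x else .y)

open scoped Classical in
-- Both parities of `k` are needed for the induction: one multiplication changes the parity and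
-- exchanges odd and even positions of the remaining list.
lemma foldl_zigzagLetter (T₀ : Finset ℕ) (l : List ℕ) (γ : Grassmann F) (k : ℕ) :
    (l.map (zigzagLetter T₀)).foldl (· * ·) (zigzagTensor γ (.m k))
      = if (Even k ∧ (∀ j ∈ (splitList l).1, j ∈ T₀) ∧ ∀ j ∈ (splitList l).2, j ∉ T₀) ∨
          (¬Even k ∧ (∀ j ∈ (splitList l).1, j ∉ T₀) ∧ ∀ j ∈ (splitList l).2, j ∈ T₀)
        then zigzagTensor (γ * (l.map (gen F)).prod) (.m (k + l.length)) else 0 := by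
  induction l generalizing γ k with
  | nil => simp [splitList]
  | cons a l ih =>
    rw [List.map_cons, List.foldl_cons]
    have e : k + 1 + l.length = k + (l.length + 1) := by omega
    by_cases hk : Even k <;> by_cases ha : a ∈ T₀ <;>
      simp [zigzagLetter, ha, hk, zigzagTensor_m_mul_x, zigzagTensor_m_mul_y, splitList, ih,
        Nat.even_add_one, foldl_zero, mul_assoc, e, and_comm]

lemma foldl_zigzagLetter_zero (T₀ : Finset ℕ) (l : List ℕ) (γ : Grassmann F) :
    (l.map (zigzagLetter T₀)).foldl (· * ·) (zigzagTensor γ (.m 0))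
      = zigzagTensor (γ * patternProd T₀ l) (.m l.length) := by
  classical
  rw [foldl_zigzagLetter, patternProd]
  by_cases h : IsPattern T₀ l
  · rw [if_pos (Or.inl ⟨Even.zero, h⟩), if_pos h, zero_add]
  · rw [if_neg, if_neg h, mul_zero, zigzagTensor_zero]
    rintro (⟨_, h'⟩ | ⟨h', _⟩)
    · exact h h'
    · exact h' Even.zero

lemma foldl_zigzagTensor_eq_zero {ι : Type*} (γ : ι → Grassmann F) (b : ι → ZigzagBasis)
    (l : List ι) (δ : Grassmann F) (r : ℕ) (i : ι) (hi : i ∈ l) (t : ℕ) (ht : b i = .m t) :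
    (l.map fun j => zigzagTensor (γ j) (b j)).foldl (· * ·) (zigzagTensor δ (.m r)) = 0 := by
  induction l generalizing δ r with
  | nil => simp at hi
  | cons a l ih =>
    rw [List.map_cons, List.foldl_cons]
    rcases List.mem_cons.1 hi with rfl | hi
    · rw [ht, zigzagTensor_m_mul_m, foldl_zero]
    · obtain ⟨ε, k, h⟩ := exists_zigzagTensor_mul δ (γ a) (.m r) (b a)
      rw [h]
      exact ih _ _ hi

/-- The substitution of `1 ⊗ m₀` for one variable and of odd elements for the others. -/
def zigzagSubst (T₀ : Finset ℕ) (i j : ℕ) : Grassmann F ⊗[F] ZigzagSpace F :=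
  zigzagTensor (if j = i then 1 else gen F j) (if j = i then .m 0 else if j ∈ T₀ then .x else .y)

lemma zigzagSubst_mem (T₀ : Finset ℕ) (i j : ℕ) :
    zigzagSubst T₀ i j ∈ envelopeSubspace (zigzagAlgebra F) := by
  unfold zigzagSubst
  refine zigzagTensor_mem ?_
  by_cases h : j = i
  · simp only [h, if_true, ZigzagBasis.parity, Nat.cast_zero]
    exact one_mem_grassmannPart
  · by_cases h' : j ∈ T₀ <;> simp only [h, h', if_true, if_false, ZigzagBasis.parity] <;>
      exact gen_mem j

lemma zigzagSubst_self (T₀ : Finset ℕ) (i : ℕ) :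
    zigzagSubst T₀ i i = zigzagTensor (1 : Grassmann F) (.m 0) := by
  simp [zigzagSubst]

lemma zigzagSubst_of_ne (T₀ : Finset ℕ) {i j : ℕ} (h : j ≠ i) :
    zigzagSubst T₀ i j = (zigzagLetter T₀ j : Grassmann F ⊗[F] ZigzagSpace F) := by
  simp [zigzagSubst, zigzagLetter, h]

lemma foldl_zigzagSubst_self (T₀ : Finset ℕ) (i : ℕ) (l : List ℕ) (hi : i ∉ l) :
    (l.map (zigzagSubst T₀ i)).foldl (· * ·) (zigzagSubst T₀ i i)
      = zigzagTensor (patternProd T₀ l : Grassmann F) (.m l.length) := by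
  have : l.map (zigzagSubst T₀ i) = l.map (zigzagLetter (F := F) T₀) :=
    List.map_congr_left fun j hj => zigzagSubst_of_ne T₀ fun h => hi (h ▸ hj)
  rw [this, zigzagSubst_self, foldl_zigzagLetter_zero, one_mul]

/-- If `i` is one of the two heads, commutativity lets the word start at `m₀`. If it occurs later,
`m₀` meets another `m` and the word dies. -/
lemma foldl_zigzagSubst (T₀ : Finset ℕ) (i p q : ℕ) (k : List ℕ) (hn : (p :: q :: k).Nodup)
    (hi : i ∈ p :: q :: k) :
    (k.map (zigzagSubst T₀ i)).foldl (· * ·) (zigzagSubst T₀ i p * zigzagSubst T₀ i q)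
      = zigzagTensor ((if p = i then patternProd T₀ (q :: k) else 0)
        + if q = i then patternProd T₀ (p :: k) else 0 : Grassmann F) (.m (k.length + 1)) := by
  simp only [List.nodup_cons, List.mem_cons, not_or] at hn
  obtain ⟨⟨hpq, hpk⟩, hqk, hk⟩ := hn
  by_cases hp : p = i
  · subst hp
    have h := foldl_zigzagSubst_self (F := F) T₀ p (q :: k) (by simp [hpq, hpk])
    rw [List.map_cons, List.foldl_cons] at h
    simpa [Ne.symm hpq] using h
  by_cases hq : q = i
  · subst hq
    have h := foldl_zigzagSubst_self (F := F) T₀ q (p :: k) (by simp [Ne.symm hpq, hqk])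
    rw [List.map_cons, List.foldl_cons] at h
    rw [zigzag_mul_comm (zigzagSubst_mem T₀ q p) (zigzagSubst_mem T₀ q q)]
    simpa [hpq] using h
  · have hik : i ∈ k := by
      simp only [List.mem_cons] at hi
      rcases hi with h | h | h
      · exact absurd h.symm hp
      · exact absurd h.symm hq
      · exact h
    simp only [hp, hq, if_false, add_zero, zigzagTensor_zero]
    obtain ⟨ε, r, h⟩ := exists_zigzagTensor_mul (if p = i then 1 else gen F p)
      (if q = i then 1 else gen F q) (if p = i then .m 0 else if p ∈ T₀ then .x else .y)
      (if q = i then .m 0 else if q ∈ T₀ then .x else .y)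
    unfold zigzagSubst
    rw [h]
    exact foldl_zigzagTensor_eq_zero _ _ k ε r i hik 0 (by simp)

lemma length_splitList {α : Type*} (l : List α) :
    (splitList l).1.length = (l.length + 1) / 2 ∧ (splitList l).2.length = l.length / 2 := by
  induction l with
  | nil => simp [splitList]
  | cons a l ih => simp [splitList, ih]; omega

/-- Without repetitions, odd-position and even-position entries partition the letters of `Y`, so the
two inclusions in a pattern force equality. -/
lemma isPattern_iff {l l₀ Y : List ℕ} (hY : Y.Nodup) (hl : l.Perm Y) (hl₀ : l₀.Perm Y) :
    IsPattern (splitList l₀).1.toFinset l ↔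
      (splitList l).1.toFinset = (splitList l₀).1.toFinset := by
  have p := (splitList_perm l).trans hl
  have p₀ := (splitList_perm l₀).trans hl₀
  have n := p.nodup_iff.2 hY
  rw [List.nodup_append] at n
  constructor
  · rintro ⟨h₁, h₂⟩
    ext j
    rw [List.mem_toFinset]
    refine ⟨h₁ j, fun hj => ?_⟩
    have hjY := p₀.mem_iff.1 (List.mem_append_left _ (List.mem_toFinset.1 hj))
    rcases List.mem_append.1 (p.mem_iff.2 hjY) with h | h
    · exact h
    · exact absurd hj (h₂ j h)
  · intro h
    refine ⟨fun j hj => h ▸ List.mem_toFinset.2 hj, fun j hj hj' => ?_⟩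
    rw [← h, List.mem_toFinset] at hj'
    exact n.2.2 j hj' j hj rfl

/-! ### Identities of the zigzag superalgebra -/

/-- A two-headed word `p q k` read with one of its heads put aside: the head. -/
def headOf {κ : Type*} (p q : κ → ℕ) (e : κ × Bool) : ℕ := cond e.2 (q e.1) (p e.1)

/-- A two-headed word `p q k` read with one of its heads put aside: the remaining letters. -/
def restOf {κ : Type*} (p q : κ → ℕ) (k : κ → List ℕ) (e : κ × Bool) : List ℕ :=
  cond e.2 (p e.1) (q e.1) :: k e.1

/-- The relation on coefficients obtained by evaluating at `zigzagSubst T₀ i`. The Boolean records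
which head of a word is the distinguished variable `i`. -/
lemma sum_patternProd_eq_zero [CharZero F] {κ : Type*} (s : Finset κ) (c : κ → F) (p q : κ → ℕ)
    (k : κ → List ℕ) (X : Finset ℕ)
    (hX : ∀ w ∈ s, ((p w :: q w :: k w : List ℕ) : Multiset ℕ) = X.val)
    (h : ∀ a : ℕ → (grassmannEnvelope (zigzagAlgebra F)).carrier,
      ∑ w ∈ s, c w • ((k w).map a).foldl (· * ·) (a (p w) * a (q w)) = 0)
    (i : ℕ) (hi : i ∈ X) (T₀ : Finset ℕ) :
    ∑ e ∈ s ×ˢ (Finset.univ : Finset Bool) with headOf p q e = i,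
      c e.1 • (patternProd T₀ (restOf p q k e) : Grassmann F) = 0 := by
  have h₁ := congrArg (envelopeIncl (zigzagAlgebra F))
    (h fun j => envelopeMk (zigzagAlgebra F) _ (zigzagSubst_mem T₀ i j))
  rw [map_sum, map_zero] at h₁
  -- Starting from `m₀`, the other `X.card - 1` letters each raise the index by one. All words thus
  -- land on the same basis vector, whose Grassmann coefficients can be compared.
  have h₂ : ∀ w ∈ s, envelopeIncl (zigzagAlgebra F) (c w • ((k w).map fun j =>
      envelopeMk (zigzagAlgebra F) _ (zigzagSubst_mem T₀ i j)).foldl (· * ·)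
        (envelopeMk (zigzagAlgebra F) _ (zigzagSubst_mem T₀ i (p w))
          * envelopeMk (zigzagAlgebra F) _ (zigzagSubst_mem T₀ i (q w))))
      = zigzagTensor (c w • ((if p w = i then patternProd T₀ (q w :: k w) else 0)
        + if q w = i then patternProd T₀ (p w :: k w) else 0) : Grassmann F)
          (.m (X.card - 1)) := by
    intro w hw
    have hn : (p w :: q w :: k w).Nodup := by
      rw [← Multiset.coe_nodup, hX w hw]; exact X.nodup
    have hm : i ∈ p w :: q w :: k w := by
      rw [← Multiset.mem_coe, hX w hw]; exact hi
    have hl : X.card - 1 = (k w).length + 1 := by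
      have := congrArg Multiset.card (hX w hw)
      simp only [Multiset.coe_card, List.length_cons, Finset.card_val] at this
      omega
    rw [map_smul, map_foldl, map_mul, zigzagTensor_smul, hl]
    exact congrArg _ (foldl_zigzagSubst T₀ i (p w) (q w) (k w) hn hm)
  have h₃ : ∀ f : κ → Grassmann F, ∑ w ∈ s, zigzagTensor (f w) (.m (X.card - 1))
      = zigzagTensor (∑ w ∈ s, f w) (.m (X.card - 1)) := fun f =>
    (TensorProduct.sum_tmul s f _).symm
  have h₄ := (h₃ _).symm.trans ((Finset.sum_congr rfl h₂).symm.trans h₁)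
  have h₅ := zigzagTensor_eq_zero h₄
  rw [Finset.sum_filter, Finset.sum_product]
  refine Eq.trans ?_ h₅
  refine Finset.sum_congr rfl fun w _ => ?_
  rw [Fintype.sum_bool, smul_add, add_comm]
  simp only [headOf, restOf, cond_true, cond_false, smul_ite, smul_zero]
  rfl

lemma foldl_mul_map_gen (l : List ℕ) :
    zigzag (1 : Grassmann F) ((splitList l).1.map (gen F)) ((splitList l).2.map (gen F))
      = (l.map (gen F)).prod := by
  have h := zigzag_splitList (1 : Grassmann F) (l.map (gen F))
  rw [splitList_map] at h
  rw [h, List.prod_eq_foldl]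

/-- The nonvanishing doubly alternating function against which all others are compared: the product
of Grassmann generators, with odd and even positions kept apart. -/
lemma zigzag_gen_alternating :
    (∀ T : List ℕ, ListAlternating fun S : List ℕ => zigzag (1 : Grassmann F) (S.map (gen F)) (T.map (gen F))) ∧
      ∀ S : List ℕ, ListAlternating fun T : List ℕ => zigzag (1 : Grassmann F) (S.map (gen F)) (T.map (gen F)) :=
  zigzag_map_alternating (gen F) (P := fun _ => True) (fun _ _ _ => trivial)
    (fun w a b c _ => mul_mul_reverse (gen_mem a) (gen_mem b) (gen_mem c) w) trivial

/-- Combinations of two-headed words which vanish on the zigzag superalgebra vanish on all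
metabelian Jordan algebras. -/
lemma sum_words_eq_zero [CharZero F] {κ : Type*} (s : Finset κ) (c : κ → F) (p q : κ → ℕ)
    (k : κ → List ℕ) (X : Finset ℕ)
    (hX : ∀ w ∈ s, ((p w :: q w :: k w : List ℕ) : Multiset ℕ) = X.val)
    (h : ∀ a : ℕ → (grassmannEnvelope (zigzagAlgebra F)).carrier,
      ∑ w ∈ s, c w • ((k w).map a).foldl (· * ·) (a (p w) * a (q w)) = 0)
    {B : NAAlgebra F} (hB : B ∈ metabelianJordan F) (a : ℕ → B.carrier) :
    ∑ w ∈ s, c w • ((k w).map a).foldl (· * ·) (a (p w) * a (q w)) = 0 := by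
  classical
  have hhead : ∀ e ∈ s ×ˢ (Finset.univ : Finset Bool),
      ((headOf p q e :: restOf p q k e : List ℕ) : Multiset ℕ) = X.val := by
    rintro ⟨w, b⟩ he
    have hw := (Finset.mem_product.1 he).1
    rw [← hX w hw, Multiset.coe_eq_coe]
    cases b
    · exact List.Perm.refl _
    · exact List.Perm.swap _ _ _
  -- The relation found in the Grassmann algebra is transferred to `zigzagSum`, for each head `i`
  -- separately.
  have h₁ : ∀ i ∈ X, ∑ e ∈ s ×ˢ (Finset.univ : Finset Bool) with headOf p q e = i,
      c e.1 • zigzagSum (a i) ((splitList (restOf p q k e)).1.map a)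
        ((splitList (restOf p q k e)).2.map a) = 0 := by
    intro i hi
    have hperm : ∀ e ∈ (s ×ˢ (Finset.univ : Finset Bool)).filter (fun e => headOf p q e = i),
        (restOf p q k e).Perm (X.erase i).toList := by
      intro e he
      obtain ⟨he', rfl⟩ := Finset.mem_filter.1 he
      rw [← Multiset.coe_eq_coe, Finset.coe_toList, Finset.erase_val, ← hhead e he']
      simp
    refine sum_eq_zero_of_alternating _ (fun e => c e.1)
      (fun e => (splitList (restOf p q k e)).1) (fun e => (splitList (restOf p q k e)).2)
      (X.erase i).nodup_toList (fun e he => (splitList_perm _).trans (hperm e he))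
      (fun T S => zigzag (1 : Grassmann F) (T.map (gen F)) (S.map (gen F)))
      zigzag_gen_alternating.1 zigzag_gen_alternating.2 (fun e he => ?_) (fun e₀ he₀ => ?_)
      (fun T S => zigzagSum (a i) (T.map a) (S.map a))
      (fun S => (zigzagSum_alternating_left hB (a i) (S.map a)).comp_map a)
      (fun T => (zigzagSum_alternating_right hB (a i) (T.map a)).comp_map a)
    · rw [foldl_mul_map_gen]
      exact gen_prod_ne_zero ((hperm e he).nodup_iff.2 (X.erase i).nodup_toList)
    · have h₂ := sum_patternProd_eq_zero s c p q k X hX h i hi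
        (splitList (restOf p q k e₀)).1.toFinset
      rw [Finset.sum_filter]
      refine Eq.trans (Finset.sum_congr rfl fun e he => ?_) h₂
      rw [foldl_mul_map_gen, patternProd,
        isPattern_iff (X.erase i).nodup_toList (hperm e he) (hperm e₀ he₀), smul_ite, smul_zero]
      congr
  have h₂ : ∑ e ∈ s ×ˢ (Finset.univ : Finset Bool),
      c e.1 • zigzagSum (a (headOf p q e)) ((splitList (restOf p q k e)).1.map a)
        ((splitList (restOf p q k e)).2.map a) = 0 := by
    rw [← Finset.sum_fiberwise_of_maps_to (t := X) (g := headOf p q)]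
    · refine Finset.sum_eq_zero fun i hi => ?_
      rw [← h₁ i hi]
      refine Finset.sum_congr rfl fun e he => ?_
      rw [(Finset.mem_filter.1 he).2]
    · intro e he
      rw [← Finset.mem_val, ← hhead e he]
      simp
  rw [Finset.sum_product] at h₂
  -- Summed over all heads, each word contributes its two readings, which add up by
  -- `zigzagSum_add_zigzagSum`. The list `T` there consists of the even positions of `k w`, hence
  -- has length `(X.card - 2) / 2`, the same for all words.
  have h₃ : ((((X.card - 2) / 2 + 2 : ℕ) : F)) •
      ∑ w ∈ s, c w • ((k w).map a).foldl (· * ·) (a (p w) * a (q w)) = 0 := by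
    rw [← h₂, Finset.smul_sum]
    refine Finset.sum_congr rfl fun w hw => ?_
    have hl : X.card - 2 = (k w).length := by
      have := congrArg Multiset.card (hX w hw)
      simp only [Multiset.coe_card, List.length_cons, Finset.card_val] at this
      omega
    have h₄ := zigzagSum_add_zigzagSum hB (a (p w)) (a (q w)) ((splitList (k w)).2.map a)
      ((splitList (k w)).1.map a)
    have h₅ := zigzag_splitList (a (p w) * a (q w)) ((k w).map a)
    rw [splitList_map] at h₅
    rw [h₅, List.length_map, (length_splitList _).2] at h₄
    rw [Fintype.sum_bool, ← smul_add, smul_comm, Nat.cast_smul_eq_nsmul, hl, ← h₄]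
    exact congrArg (c w • ·) (add_comm _ _)
  exact (smul_eq_zero.1 h₃).resolve_left (Nat.cast_ne_zero.2 (by omega))

/-- A multilinear identity of the zigzag superalgebra holds in all metabelian Jordan algebras. -/
lemma satisfies_of_satisfiesSuper_zigzagAlgebra [CharZero F] {f : Poly F} (hf : IsMultilinear f)
    (h : SatisfiesSuper (zigzagAlgebra F) f) {B : NAAlgebra F} (hB : B ∈ metabelianJordan F) :
    Satisfies B f := by
  classical
  obtain ⟨X, hX⟩ := hf
  have key : ∀ w : FreeMagma ℕ, ∃ (i : ℕ) (l : List ℕ),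
      (¬∀ B ∈ metabelianJordan F, ∀ a : ℕ → B.carrier, FreeMagma.lift a w = 0) →
      ((i :: l : List ℕ) : Multiset ℕ) = letters w ∧
      ∀ B ∈ metabelianJordan F, ∀ a : ℕ → B.carrier,
        FreeMagma.lift a w = (l.map a).foldl (· * ·) (a i) := by
    intro w
    rcases exists_leftNormed F w with hw | ⟨i, l, hw⟩
    · exact ⟨0, [], fun hw' => absurd hw hw'⟩
    · exact ⟨i, l, fun _ => hw⟩
  choose i l hil using key
  -- Words vanishing on the whole variety have no left-normed form and are discarded; the default
  -- `⟨0, []⟩` chosen for them is never used.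
  let s := f.coeff.support.filter fun w =>
    ¬∀ B ∈ metabelianJordan F, ∀ a : ℕ → B.carrier, FreeMagma.lift a w = 0
  have hs : ∀ w ∈ s, ((i w :: l w : List ℕ) : Multiset ℕ) = X.val := fun w hw => by
    obtain ⟨h₁, h₂⟩ := Finset.mem_filter.1 hw
    rw [(hil w h₂).1, hX w (Finsupp.mem_support_iff.1 h₁)]
  have heval : ∀ B ∈ metabelianJordan F, ∀ a : ℕ → B.carrier,
      FreeNonUnitalNonAssocAlgebra.lift F a f
        = ∑ w ∈ s, f.coeff w • ((l w).map a).foldl (· * ·) (a (i w)) := by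
    intro B hB a
    rw [lift_eq_sum, Finset.sum_filter]
    refine Finset.sum_congr rfl fun w _ => ?_
    split_ifs with hw
    · rw [hw B hB a, smul_zero]
    · rw [(hil w hw).2 B hB a]
  intro a
  rw [heval B hB a]
  have hlen : ∀ w ∈ s, (l w).length + 1 = X.card := fun w hw => by
    have := congrArg Multiset.card (hs w hw)
    simpa using this
  have hD : ∀ a, _ := heval _ (zigzagAlgebra_mem F)
  -- In degree one a word has no second head, so the coefficient is read off directly from the value
  -- at `1 ⊗ m₀`.
  by_cases hX1 : X.card = 1
  · obtain ⟨i₀, rfl⟩ := Finset.card_eq_one.1 hX1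
    have hw₀ : ∀ w ∈ s, l w = [] ∧ i w = i₀ := by
      intro w hw
      have h₁ : l w = [] := List.length_eq_zero_iff.1 (by have := hlen w hw; simp at this; simpa)
      have h₂ := hs w hw
      rw [h₁] at h₂
      exact ⟨h₁, by simpa using h₂⟩
    have hsum : ∀ B : NAAlgebra F, ∀ a : ℕ → B.carrier,
        ∑ w ∈ s, f.coeff w • ((l w).map a).foldl (· * ·) (a (i w))
          = (∑ w ∈ s, f.coeff w) • a i₀ := by
      intro B a
      rw [Finset.sum_smul]
      refine Finset.sum_congr rfl fun w hw => ?_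
      rw [(hw₀ w hw).1, (hw₀ w hw).2]
      rfl
    let b : ℕ → (grassmannEnvelope (zigzagAlgebra F)).carrier := fun j =>
      envelopeMk (zigzagAlgebra F) _ (zigzagSubst_mem ∅ i₀ j)
    have h₂ := congrArg (envelopeIncl (zigzagAlgebra F))
      ((hsum _ b).symm.trans ((hD b).symm.trans (h b)))
    rw [map_smul, map_zero] at h₂
    have h₃ : zigzagTensor ((∑ w ∈ s, f.coeff w) • (1 : Grassmann F)) (.m 0) = 0 := by
      rw [zigzagTensor_smul, ← zigzagSubst_self ∅ i₀]
      exact h₂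
    have h₄ := (smul_eq_zero.1 (zigzagTensor_eq_zero h₃)).resolve_right one_ne_zero
    rw [hsum, h₄, zero_smul]
  · have hex : ∀ w, ∃ (q : ℕ) (k : List ℕ), w ∈ s → l w = q :: k := by
      intro w
      rcases hlw : l w with - | ⟨q, k⟩
      · exact ⟨0, [], fun hw => absurd (hlen w hw).symm (by rw [hlw]; exact hX1)⟩
      · exact ⟨q, k, fun _ => rfl⟩
    choose q k hqk using hex
    have hfold : ∀ (B : NAAlgebra F) (a : ℕ → B.carrier),
        ∑ w ∈ s, f.coeff w • ((l w).map a).foldl (· * ·) (a (i w))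
          = ∑ w ∈ s, f.coeff w • ((k w).map a).foldl (· * ·) (a (i w) * a (q w)) := by
      intro B a
      refine Finset.sum_congr rfl fun w hw => ?_
      rw [hqk w hw]
      rfl
    rw [hfold]
    refine sum_words_eq_zero s f.coeff i q k X (fun w hw => ?_) (fun b => ?_) hB a
    · rw [← hqk w hw, hs w hw]
    · exact (hfold _ b).symm.trans ((hD b).symm.trans (h b))

section SuperRankZeroTwo

/-! ### Multilinear polynomials -/

/-- All monomials of the polynomial have the given multiset of letters. -/
def HasLetters (X : Multiset ℕ) (f : Poly F) : Prop :=
  ∀ w : FreeMagma ℕ, f.coeff w ≠ 0 → letters w = X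

lemma HasLetters.isMultilinear {X : Finset ℕ} {f : Poly F} (h : HasLetters X.val f) :
    IsMultilinear f :=
  ⟨X, h⟩

lemma hasLetters_var (n : ℕ) : HasLetters {n} (var F n) := by
  intro w hw
  have : (var F n).coeff = Finsupp.single (FreeMagma.of n) 1 := rfl
  rw [this, Finsupp.single_apply_ne_zero] at hw
  rw [hw.1]
  rfl

lemma HasLetters.add {X : Multiset ℕ} {f g : Poly F} (hf : HasLetters X f)
    (hg : HasLetters X g) : HasLetters X (f + g) := by
  intro w hw
  by_cases h : f.coeff w = 0
  · refine hg w fun h' => hw ?_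
    rw [MonoidAlgebra.coeff_add, Finsupp.add_apply, h, h', add_zero]
  · exact hf w h

lemma HasLetters.sub {X : Multiset ℕ} {f g : Poly F} (hf : HasLetters X f)
    (hg : HasLetters X g) : HasLetters X (f - g) := by
  intro w hw
  by_cases h : f.coeff w = 0
  · refine hg w fun h' => hw ?_
    rw [MonoidAlgebra.coeff_sub, Finsupp.sub_apply, h, h', sub_zero]
  · exact hf w h

lemma HasLetters.mul {X Y : Multiset ℕ} {f g : Poly F} (hf : HasLetters X f)
    (hg : HasLetters Y g) : HasLetters (X + Y) (f * g) := by
  classical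
  intro w hw
  by_contra h
  refine hw ?_
  rw [MonoidAlgebra.coeff_mul]
  refine Finset.sum_eq_zero fun v hv => Finset.sum_eq_zero fun u hu => if_neg ?_
  rintro rfl
  refine h ?_
  rw [← hf v (Finsupp.mem_support_iff.1 hv), ← hg u (Finsupp.mem_support_iff.1 hu)]
  rfl

lemma isMultilinear_commutativity : IsMultilinear (commutativity F) := by
  refine HasLetters.isMultilinear (X := {0, 1}) ?_
  have h := (hasLetters_var (F := F) 1).mul (hasLetters_var 0)
  rw [add_comm] at h
  exact ((hasLetters_var 0).mul (hasLetters_var 1)).sub h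

lemma isMultilinear_metabelianity : IsMultilinear (metabelianity F) := by
  refine HasLetters.isMultilinear (X := {0, 1, 2, 3}) ?_
  exact ((hasLetters_var 0).mul (hasLetters_var 1)).mul ((hasLetters_var 2).mul (hasLetters_var 3))

lemma isMultilinear_jordanForm :
    IsMultilinear (jordanForm (var F 0) (var F 1) (var F 2) (var F 3)) := by
  have h : ∀ a b c d : ℕ, ({a} + {b} + {c} + {d} : Multiset ℕ) = {0, 1, 2, 3} →
      HasLetters {0, 1, 2, 3} (var F a * var F b * var F c * var F d) := fun a b c d e => e ▸
    (((hasLetters_var a).mul (hasLetters_var b)).mul (hasLetters_var c)).mul (hasLetters_var d)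
  refine HasLetters.isMultilinear (X := {0, 1, 2, 3}) ?_
  exact ((h 0 1 3 2 (by decide)).add (h 0 2 3 1 (by decide))).add (h 1 2 3 0 (by decide))

lemma satisfies_jordanForm_iff (B : NAAlgebra F) :
    Satisfies B (jordanForm (var F 0) (var F 1) (var F 2) (var F 3)) ↔
      ∀ x y z t : B.carrier, jordanForm x y z t = 0 := by
  constructor
  · intro h x y z t
    have := h fun n => if n = 0 then x else if n = 1 then y else if n = 2 then z else t
    simpa [jordanForm, lift_var] using this
  · intro h a
    simpa [jordanForm] using h (a 0) (a 1) (a 2) (a 3)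

/-! ### Two odd generators suffice -/

lemma satisfiesSuper_of_surjective {A B : SuperAlgebra F} (φ : A.carrier →ₙₐ[F] B.carrier)
    (hφ : ∀ i, ∀ a ∈ A.part i, φ a ∈ B.part i)
    (hs : ∀ i, ∀ b ∈ B.part i, ∃ a ∈ A.part i, φ a = b) {f : Poly F} (h : SatisfiesSuper A f) :
    SatisfiesSuper B f := by
  have hsurj : ∀ y ∈ envelopeSubspace B, ∃ x : (grassmannEnvelope A).carrier,
      envelopeIncl B (envelopeMap φ hφ x) = y := by
    intro y hy
    refine envelopeSubspace_induction B
      (P := fun y => ∃ x, envelopeIncl B (envelopeMap φ hφ x) = y) ⟨0, ?_⟩ ?_ ?_ hy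
    · rw [map_zero, map_zero]
    · rintro _ _ ⟨x, rfl⟩ ⟨x', rfl⟩
      exact ⟨x + x', by rw [map_add, map_add]⟩
    · intro i g b hg hb
      obtain ⟨a, ha, rfl⟩ := hs i b hb
      exact ⟨envelopeMk A _ (tmul_mem_envelopeSubspace A hg ha), rfl⟩
  intro b
  choose a ha using fun n => hsurj _ (envelopeIncl_mem B (b n))
  have hab : b = fun n => envelopeMap φ hφ (a n) :=
    funext fun n => (envelopeIncl_injective B (ha n)).symm
  rw [hab, ← map_lift, h a, map_zero]

variable [CharZero F]

/-- Only multilinear identities pass to the generated supervariety, so the Jordan identity has to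
travel in its linearised form `jordanForm`. -/
lemma superVarietyGeneratedBy_subset {A : SuperAlgebra F}
    (hA : A ∈ superVariety (metabelianJordan F)) :
    superVarietyGeneratedBy A ⊆ superVariety (metabelianJordan F) := by
  intro B hB
  obtain ⟨h₁, h₂, h₃⟩ := (mem_metabelianJordan_iff _).1 hA
  exact (mem_metabelianJordan_iff _).2
    ⟨(satisfies_commutativity_iff _).1
      (hB _ isMultilinear_commutativity ((satisfies_commutativity_iff _).2 h₁)),
    (satisfies_metabelianity_iff _).1
      (hB _ isMultilinear_metabelianity ((satisfies_metabelianity_iff _).2 h₂)),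
    (satisfies_jordanForm_iff _).1
      (hB _ isMultilinear_jordanForm ((satisfies_jordanForm_iff _).2 h₃))⟩

/-- The images of the two odd generators in the zigzag superalgebra. -/
def zigzagGenerator : Fin 0 ⊕ Fin 2 → ZigzagSpace F :=
  Sum.elim (fun _ => 0) ![zigzagBasis F .x, zigzagBasis F .y]

/-- The odd elements `x` and `y` generate the zigzag superalgebra, so it is a graded image of the
free superalgebra on two odd generators. -/
lemma satisfiesSuper_zigzagAlgebra {f : Poly F}
    (h : SatisfiesSuper (freeSuperAlgebra (genParity 0 2) (superVariety (metabelianJordan F))) f) :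
    SatisfiesSuper (zigzagAlgebra F) f := by
  let A := freeSuperAlgebra (genParity 0 2) (superVariety (metabelianJordan F))
  have hb : ∀ i, zigzagGenerator (F := F) i ∈ (zigzagAlgebra F).part (genParity 0 2 i) := by
    rintro (i | i)
    · exact i.elim0
    · fin_cases i
      · exact zigzagBasis_mem_part .x
      · exact zigzagBasis_mem_part .y
  let φ : A.carrier →ₙₐ[F] (zigzagAlgebra F).carrier := freeSuperLift (genParity 0 2)
    (superVariety (metabelianJordan F)) (zigzagAlgebra_mem F) zigzagGenerator hb
  have hgen : ∀ i : Fin 2, ∃ a ∈ A.part 1, φ a = zigzagGenerator (F := F) (.inr i) := fun i =>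
    ⟨_, ⟨FreeNonUnitalNonAssocAlgebra.of F (.inr i),
      Submodule.subset_span ⟨FreeMagma.of (.inr i), rfl, rfl⟩, rfl⟩,
      (freeSuperLift_mk _ _ _ _ _ _).trans (FreeNonUnitalNonAssocAlgebra.lift_of_apply F _ _)⟩
  obtain ⟨x, hx, hφx⟩ := hgen 0
  obtain ⟨y, hy, hφy⟩ := hgen 1
  replace hφx : φ x = zigzagBasis F .x := hφx
  replace hφy : φ y = zigzagBasis F .y := hφy
  have hm : ∀ k : ℕ, ∃ a ∈ A.part k, φ a = zigzagBasis F (.m k) := by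
    intro k
    induction k with
    | zero => exact ⟨x * y, A.mul_mem 1 1 x y hx hy, by
        rw [map_mul, hφx, hφy]; exact zigzagBasis_mul .x .y⟩
    | succ k ih =>
      obtain ⟨a, ha, hφa⟩ := ih
      rw [Nat.cast_succ]
      by_cases hk : Even k
      · refine ⟨a * x, A.mul_mem k 1 a x ha hx, ?_⟩
        rw [map_mul, hφx, hφa]
        refine (zigzagBasis_mul _ _).trans ?_
        rw [zigzagTable, if_pos hk]
      · refine ⟨a * y, A.mul_mem k 1 a y ha hy, ?_⟩
        rw [map_mul, hφy, hφa]
        refine (zigzagBasis_mul _ _).trans ?_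
        rw [zigzagTable, if_neg hk]
  have hbasis : ∀ b : ZigzagBasis, ∃ a ∈ A.part b.parity, φ a = zigzagBasis F b := by
    rintro (- | - | k)
    exacts [⟨x, hx, hφx⟩, ⟨y, hy, hφy⟩, hm k]
  refine satisfiesSuper_of_surjective (A := A) φ (freeSuperLift_mem_part _ _ _ _ _)
    (fun i b hb => ?_) h
  replace hb : b ∈ Submodule.span F (zigzagBasis F '' {b | b.parity = i}) :=
    (zigzagPart_eq_span i).le hb
  have hle : Submodule.span F (zigzagBasis F '' {b | b.parity = i})
      ≤ (A.part i).map (φ : A.carrier →ₗ[F] (zigzagAlgebra F).carrier) := by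
    refine Submodule.span_le.2 ?_
    rintro _ ⟨b, rfl, rfl⟩
    exact hbasis b
  exact hle hb

variable (F) in
theorem superRankSubvariety_zero_two :
    superRankSubvariety (metabelianJordan F) 0 2 = superVariety (metabelianJordan F) := by
  refine (superVarietyGeneratedBy_subset (freeSuperAlgebra_mem _ _)).antisymm
    fun B hB f hf h => ?_
  exact satisfies_of_satisfiesSuper_zigzagAlgebra hf (satisfiesSuper_zigzagAlgebra h) hB

end SuperRankZeroTwo

/-! ### Products symmetrised in pairs of factors -/

/-- The result of applying to `a₀ a₁` the operators `R_y R_z + R_z R_y`, where `(y, z)` runs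
through the pairs `(a₂, a₃), (a₄, a₅), …`. -/
def symProd {R : Type*} [NonUnitalNonAssocRing R] (a : ℕ → R) : ℕ → R
  | 0 => a 0 * a 1
  | k + 1 => symProd a k * a (2 * k + 2) * a (2 * k + 3)
      + symProd a k * a (2 * k + 3) * a (2 * k + 2)

lemma map_symProd {R S : Type*} [NonUnitalNonAssocRing R] [NonUnitalNonAssocRing S] [Module F R]
    [Module F S] (φ : R →ₙₐ[F] S) (a : ℕ → R) (k : ℕ) :
    φ (symProd a k) = symProd (fun n => φ (a n)) k := by
  induction k with
  | zero => simp [symProd]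
  | succ k ih => simp [symProd, ih]

lemma isMultilinear_symProd (k : ℕ) : IsMultilinear (symProd (var F) k) := by
  have h : HasLetters (Multiset.range (2 * k + 2)) (symProd (var F) k) := by
    induction k with
    | zero => exact (hasLetters_var 0).mul (hasLetters_var 1)
    | succ k ih =>
      have e₁ : Multiset.range (2 * k + 2) + {2 * k + 2} + {2 * k + 3}
          = Multiset.range (2 * (k + 1) + 2) := by
        rw [show 2 * (k + 1) + 2 = 2 * k + 2 + 1 + 1 by ring,
          show 2 * k + 3 = 2 * k + 2 + 1 by ring]
        generalize 2 * k + 2 = n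
        rw [Multiset.range_succ, Multiset.range_succ, ← Multiset.singleton_add,
          ← Multiset.singleton_add]
        abel
      have e₂ : Multiset.range (2 * k + 2) + {2 * k + 3} + {2 * k + 2}
          = Multiset.range (2 * (k + 1) + 2) := by
        rw [← e₁, add_right_comm]
      have h₁ := (ih.mul (hasLetters_var (2 * k + 2))).mul (hasLetters_var (2 * k + 3))
      have h₂ := (ih.mul (hasLetters_var (2 * k + 3))).mul (hasLetters_var (2 * k + 2))
      rw [e₁] at h₁
      rw [e₂] at h₂
      exact h₁.add h₂
  exact HasLetters.isMultilinear (X := Finset.range (2 * k + 2)) h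

lemma lift_symProd (B : NAAlgebra F) (a : ℕ → B.carrier) (k : ℕ) :
    FreeNonUnitalNonAssocAlgebra.lift F a (symProd (var F) k) = symProd a k := by
  rw [map_symProd]
  simp only [lift_var]

variable (F) in
-- With `x` for even and `y` for odd indices, `m₂ₖ x y` survives and `m₂ₖ y x` vanishes. Nothing
-- cancels, and the value is a product of distinct generators on `m₂ₖ`.
lemma not_satisfiesSuper_zigzagAlgebra_symProd (k : ℕ) :
    ¬SatisfiesSuper (zigzagAlgebra F) (symProd (var F) k) := by
  intro h
  have hmem : ∀ n : ℕ, zigzagTensor (gen F n) (if Even n then .x else .y)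
      ∈ envelopeSubspace (zigzagAlgebra F) := fun n => by
    refine zigzagTensor_mem ?_
    split_ifs <;> exact gen_mem n
  have h₁ := congrArg (envelopeIncl (zigzagAlgebra F))
    (h fun n => envelopeMk (zigzagAlgebra F) _ (hmem n))
  rw [lift_symProd, map_symProd, map_zero] at h₁
  have h₂ : ∀ k : ℕ, symProd (fun n => zigzagTensor (gen F n) (if Even n then .x else .y)) k
      = zigzagTensor ((List.range (2 * k + 2)).map (gen F)).prod (.m (2 * k)) := by
    intro k
    induction k with
    | zero =>
      simp [symProd, zigzagTensor_x_mul_y, List.range_succ]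
    | succ k ih =>
      have e₁ : Even (2 * k + 2) := by simp [parity_simps]
      have e₂ : ¬Even (2 * k + 3) := by
        rw [show 2 * k + 3 = 2 * k + 2 + 1 from rfl, Nat.even_add_one, not_not]; exact e₁
      have e₃ : ¬Even (2 * k + 1) := by simp [parity_simps]
      rw [symProd, ih, if_pos e₁, if_neg e₂, zigzagTensor_m_mul_x, if_pos (even_two_mul k),
        zigzagTensor_m_mul_y, if_neg e₃, zigzagTensor_m_mul_y, if_pos (even_two_mul k), zero_mul,
        add_zero, show 2 * (k + 1) + 2 = 2 * k + 2 + 1 + 1 by ring,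
        show 2 * (k + 1) = 2 * k + 1 + 1 by ring, show 2 * k + 3 = 2 * k + 2 + 1 by ring]
      generalize 2 * k + 2 = n
      rw [List.range_succ (n := n + 1), List.range_succ (n := n)]
      simp [mul_assoc]
  exact gen_prod_ne_zero List.nodup_range (zigzagTensor_eq_zero ((h₂ k).symm.trans h₁))

/-! ### A pigeonhole criterion for the vanishing of symmetrised products -/

section Vanishing

variable {B : NAAlgebra F}

/-- A word in pairs of factors, such that each pair contains an element of one of the sets `C i`
in the position prescribed by its tag. -/
def TaggedWord {r : ℕ} (C : Fin r → Set B.carrier) (k : ℕ) (z : B.carrier) : Prop :=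
  ∃ ps : List (B.carrier × B.carrier × (Fin r ⊕ Fin r)), ps.length = k ∧
    (∀ p ∈ ps, (∀ i, p.2.2 = .inl i → p.1 ∈ C i) ∧ ∀ i, p.2.2 = .inr i → p.2.1 ∈ C i) ∧
    ∃ u v : B.carrier, z = ps.foldl (fun w p => w * p.1 * p.2.1) (u * v)

lemma TaggedWord.exists_mul {r : ℕ} {C : Fin r → Set B.carrier} {k : ℕ} {z : B.carrier}
    (h : TaggedWord C k z) : ∃ u v, z = u * v := by
  obtain ⟨ps, -, -, u, v, rfl⟩ := h
  induction ps using List.reverseRecOn with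
  | nil => exact ⟨u, v, rfl⟩
  | append_singleton l a => exact ⟨_, _, by rw [List.foldl_append]; rfl⟩

lemma TaggedWord.snoc {r : ℕ} {C : Fin r → Set B.carrier} {k : ℕ} {z : B.carrier}
    (h : TaggedWord C k z) (y y' : B.carrier) (t : Fin r ⊕ Fin r)
    (h₁ : ∀ i, t = .inl i → y ∈ C i) (h₂ : ∀ i, t = .inr i → y' ∈ C i) :
    TaggedWord C (k + 1) (z * y * y') := by
  obtain ⟨ps, hk, hps, u, v, rfl⟩ := h
  refine ⟨ps ++ [(y, y', t)], by simp [hk], fun p hp => ?_, u, v, by rw [List.foldl_append]; rfl⟩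
  rcases List.mem_append.1 hp with hp | hp
  · exact hps p hp
  · obtain rfl := List.mem_singleton.1 hp
    exact ⟨h₁, h₂⟩

lemma foldl_pairs_eq_zigzag {τ : Type*} (ps : List (B.carrier × B.carrier × τ)) (w : B.carrier) :
    ps.foldl (fun w p => w * p.1 * p.2.1) w
      = zigzag w (ps.map fun p => p.1) (ps.map fun p => p.2.1) := by
  induction ps generalizing w with
  | nil => simp [zigzag]
  | cons p ps ih => simp [zigzag_cons, ih]

lemma zigzag_cons_cons_eq_zero {w a a' : B.carrier} (h : ∀ b, w * a * b * a' = 0)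
    (S T : List B.carrier) : zigzag w (a :: a' :: S) T = 0 := by
  cases T with
  | nil => rw [zigzag_cons, zigzag_nil_cons]
  | cons t T => rw [zigzag_cons, zigzag_cons, zigzag_cons, h, zigzag_zero]

variable [CharZero F]

/-- There are only `2 * r` tags, so two pairs carry the same one. Their marked entries lie in one
class `C i` and in the same list of the zigzag; alternation brings them to its front, where `hC`
applies. -/
lemma TaggedWord.eq_zero (hB : B ∈ metabelianJordan F) {r : ℕ} {C : Fin r → Set B.carrier}
    (hC : ∀ i, ∀ a ∈ C i, ∀ a' ∈ C i, ∀ u v b : B.carrier, u * v * a * b * a' = 0)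
    {z : B.carrier} (hz : TaggedWord C (2 * r + 1) z) : z = 0 := by
  obtain ⟨ps, hk, hps, u, v, rfl⟩ := hz
  have hdup : ¬(ps.map fun p => p.2.2).Nodup := fun hn => by
    have := hn.length_le_card
    simp [hk] at this
    omega
  simp only [List.nodup_iff_sublist, not_forall, not_not] at hdup
  obtain ⟨t, ht⟩ := hdup
  obtain ⟨l, hl, hlt⟩ := List.sublist_map_iff.1 ht
  obtain ⟨p, l, rfl⟩ : ∃ p l', l = p :: l' := by
    cases l with
    | nil => simp at hlt
    | cons p l => exact ⟨p, l, rfl⟩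
  obtain ⟨p', l, rfl⟩ : ∃ p l', l = p :: l' := by
    cases l with
    | nil => simp at hlt
    | cons p l => exact ⟨p, l, rfl⟩
  obtain rfl : l = [] := by
    cases l with
    | nil => rfl
    | cons _ _ => simp at hlt
  simp only [List.map_cons, List.map_nil, List.cons.injEq, and_true] at hlt
  obtain ⟨h₁, h₂⟩ := hlt
  have hp := hps p (hl.subset (by simp))
  have hp' := hps p' (hl.subset (by simp))
  obtain ⟨alt₁, alt₂⟩ := zigzag_alternating_of_mem hB ⟨u, v, rfl⟩
  rw [foldl_pairs_eq_zigzag]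
  rcases t with i | i
  · obtain ⟨l, hperm⟩ := (hl.map fun p => p.1).exists_perm_append
    obtain ⟨ε, hε⟩ := exists_sign_of_perm.{u} hperm
    rw [hε B.carrier _ (alt₁ _), List.map_cons, List.map_cons, List.map_nil, List.cons_append,
      List.cons_append, zigzag_cons_cons_eq_zero, smul_zero]
    exact hC i _ (hp.1 i h₁.symm) _ (hp'.1 i h₂.symm) u v
  · obtain ⟨l, hperm⟩ := (hl.map fun p => p.2.1).exists_perm_append
    obtain ⟨ε, hε⟩ := exists_sign_of_perm.{u} hperm
    rw [hε B.carrier _ (alt₂ _), List.map_cons, List.map_cons, List.map_nil, List.cons_append,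
      List.cons_append]
    -- The second list comes into play only after one entry `t` of the first, so `hC` is applied to
    -- the product `(u * v) * t`.
    generalize (ps.map fun p => p.1) = T
    cases T with
    | nil => rw [zigzag_nil_cons, smul_zero]
    | cons t T =>
      rw [zigzag_cons, zigzag_cons_cons_eq_zero, smul_zero]
      exact hC i _ (hp.2 i h₁.symm) _ (hp'.2 i h₂.symm) (u * v) t

/-- If an algebra is spanned by `r` classes of elements for which the quadratic operators
`R_a R_b R_a'` vanish, one class for which the right multiplications anticommute, and elements
annihilating the square of the algebra, then all long symmetrised products vanish. -/
lemma symProd_eq_zero (hB : B ∈ metabelianJordan F) {r : ℕ} (C : Fin r → Set B.carrier)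
    (O Z : Set B.carrier)
    (hspan : ∀ z, z ∈ AddSubmonoid.closure ((⋃ i, C i) ∪ O ∪ Z))
    (hC : ∀ i, ∀ a ∈ C i, ∀ a' ∈ C i, ∀ u v b : B.carrier, u * v * a * b * a' = 0)
    (hO : ∀ o ∈ O, ∀ o' ∈ O, ∀ u v : B.carrier, u * v * o * o' + u * v * o' * o = 0)
    (hZ : ∀ z ∈ Z, ∀ u v : B.carrier, u * v * z = 0) (a : ℕ → B.carrier) :
    symProd a (2 * r + 1) = 0 := by
  -- By bilinearity `y` and `y'` may be taken from the spanning classes. An entry from some `C i`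
  -- tags the pair on the side where it stands; otherwise the two terms cancel or vanish.
  have hstep : ∀ k z, TaggedWord C k z → ∀ y y' : B.carrier,
      z * y * y' + z * y' * y ∈ AddSubmonoid.closure {z | TaggedWord C (k + 1) z} := by
    intro k z hz y y'
    obtain ⟨u, v, huv⟩ := hz.exists_mul
    have hCy : ∀ i, ∀ y ∈ C i, ∀ y', z * y * y' + z * y' * y
        ∈ AddSubmonoid.closure {z | TaggedWord C (k + 1) z} := by
      intro i y hy y'
      refine add_mem (AddSubmonoid.subset_closure (hz.snoc y y' (.inl i) ?_ ?_))
        (AddSubmonoid.subset_closure (hz.snoc y' y (.inr i) ?_ ?_)) <;> simp [hy]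
    have hZy : ∀ y ∈ Z, ∀ y', z * y * y' + z * y' * y = 0 := by
      intro y hy y'
      rw [hZ y hy z y', huv, hZ y hy u v, zero_mul, add_zero]
    refine AddSubmonoid.closure_induction (motive := fun y _ => z * y * y' + z * y' * y
      ∈ AddSubmonoid.closure {z | TaggedWord C (k + 1) z}) (fun y hy => ?_) (by simp)
      (fun y₁ y₂ _ _ h₁ h₂ => ?_) (hspan y)
    · rcases hy with (hy | hy) | hy
      · obtain ⟨i, hi⟩ := Set.mem_iUnion.1 hy
        exact hCy i y hi y'
      · refine AddSubmonoid.closure_induction (motive := fun y' _ => z * y * y' + z * y' * y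
          ∈ AddSubmonoid.closure {z | TaggedWord C (k + 1) z}) (fun y' hy' => ?_) (by simp)
          (fun y₁ y₂ _ _ h₁ h₂ => ?_) (hspan y')
        · rcases hy' with (hy' | hy') | hy'
          · obtain ⟨i, hi⟩ := Set.mem_iUnion.1 hy'
            rw [add_comm (z * y * y')]
            exact hCy i y' hi y
          · rw [huv, hO y hy y' hy']
            exact zero_mem _
          · rw [add_comm (z * y * y'), hZy y' hy']
            exact zero_mem _
        · have := add_mem h₁ h₂
          rw [add_add_add_comm] at this
          rwa [mul_add, mul_add, add_mul]
      · rw [hZy y hy]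
        exact zero_mem _
    · have := add_mem h₁ h₂
      rw [add_add_add_comm] at this
      rwa [mul_add, mul_add, add_mul]
  have hmem : ∀ k, symProd a k ∈ AddSubmonoid.closure {z | TaggedWord C k z} := by
    intro k
    induction k with
    | zero => exact AddSubmonoid.subset_closure ⟨[], rfl, by simp, a 0, a 1, rfl⟩
    | succ k ih =>
      rw [symProd]
      refine AddSubmonoid.closure_induction (motive := fun z _ => z * a (2 * k + 2) * a (2 * k + 3)
        + z * a (2 * k + 3) * a (2 * k + 2) ∈ AddSubmonoid.closure {z | TaggedWord C (k + 1) z})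
        (fun z hz => hstep k z hz _ _) (by simp) (fun z₁ z₂ _ _ h₁ h₂ => ?_) ih
      have := add_mem h₁ h₂
      rw [add_add_add_comm] at this
      simpa only [add_mul] using this
  have hbot : AddSubmonoid.closure {z | TaggedWord C (2 * r + 1) z} ≤ ⊥ :=
    (AddSubmonoid.closure_le).2 fun z hz => AddSubmonoid.mem_bot.2 (hz.eq_zero hB hC)
  exact AddSubmonoid.mem_bot.1 (hbot (hmem _))

end Vanishing

/-! ### The vanishing of symmetrised products in free algebras -/

section FreeAlgebra

variable [CharZero F]

lemma eq_zero_of_eq_neg {B : NAAlgebra F} {x : B.carrier} (h : x = -x) : x = 0 := by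
  have h₂ : (2 : F) • x = 0 := by
    rw [two_smul]
    exact add_eq_zero_iff_eq_neg.2 h
  exact (smul_eq_zero.1 h₂).resolve_left two_ne_zero

/-- The classes are the scalar multiples of single generators: by skewness `w g b g` equals its own
negative. There is no odd class, and products annihilate the square. -/
lemma satisfies_freeAlgebra_symProd (r : ℕ) :
    Satisfies (freeAlgebra (metabelianJordan F) (Fin r)) (symProd (var F) (2 * r + 1)) := by
  have hB : freeAlgebra (metabelianJordan F) (Fin r) ∈ metabelianJordan F := freeAlgebra_mem _ _
  set B := freeAlgebra (metabelianJordan F) (Fin r)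
  let π := quotientMk _ (relations_isIdeal (metabelianJordan F) (Fin r))
  let g : Fin r → B.carrier := fun i => π (FreeNonUnitalNonAssocAlgebra.of F i)
  intro a
  rw [lift_symProd]
  refine symProd_eq_zero hB (fun i => {z | ∃ c : F, z = c • g i}) ∅ {z | ∃ u v, z = u * v}
    (fun z => ?_) ?_ (by simp) ?_ a
  · obtain ⟨p, rfl⟩ := quotientMk_surjective _ (relations_isIdeal (metabelianJordan F) (Fin r)) z
    induction p using MonoidAlgebra.induction_linear with
    | zero => rw [map_zero]; exact zero_mem _
    | add p q hp hq => rw [map_add]; exact add_mem hp hq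
    | single w c =>
      refine AddSubmonoid.subset_closure ?_
      cases w with
      | of i =>
        refine Or.inl (Or.inl (Set.mem_iUnion.2 ⟨i, c, ?_⟩))
        refine Eq.trans ?_ (map_smul π c _)
        refine congrArg π ?_
        refine Eq.trans ?_ (MonoidAlgebra.smul_single c (FreeMagma.of i) (1 : F)).symm
        rw [smul_eq_mul, mul_one]
      | mul v w =>
        refine Or.inr ⟨π (MonoidAlgebra.single v c), π (MonoidAlgebra.single w 1), ?_⟩
        refine Eq.trans ?_ (quotientMk_mul _ _ _ _)
        rw [MonoidAlgebra.single_mul_single, mul_one]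
        rfl
  · rintro i _ ⟨c, rfl⟩ _ ⟨c', rfl⟩ u v b
    have : u * v * g i * b * g i = 0 :=
      eq_zero_of_eq_neg (mul_mul_mul_skew hB ⟨u, v, rfl⟩ _ _ _)
    rw [mul_smul_comm, mul_smul_comm, smul_mul_assoc, smul_mul_assoc, this, smul_zero, smul_zero]
  · rintro _ ⟨u', v', rfl⟩ u v
    exact mul_mul_mul_eq_zero hB u v u' v'

end FreeAlgebra

/-! ### Free superalgebras with at most one odd generator -/

section FreeSuperAlgebra

/-- Even coefficients are central, so this expression is symmetric in `γ, γ'`; being also skew by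
the Jordan identity in the case of interest, it will vanish. -/
lemma mul_even_mul_mul_even {A : SuperAlgebra F} {γ γ' : Grassmann F}
    (hγ : γ ∈ grassmannPart F 0) (hγ' : γ' ∈ grassmannPart F 0) (g : A.carrier)
    (w b : Grassmann F ⊗[F] A.carrier) :
    w * (γ ⊗ₜ g) * b * (γ' ⊗ₜ g) = w * (γ' ⊗ₜ g) * b * (γ ⊗ₜ g) := by
  induction w using TensorProduct.induction_on with
  | zero => simp only [zero_mul]
  | add w w' hw hw' => simp only [add_mul, hw, hw']
  | tmul δ w =>
    induction b using TensorProduct.induction_on with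
    | zero => simp only [zero_mul, mul_zero]
    | add b b' hb hb' => simp only [mul_add, add_mul, hb, hb']
    | tmul β b =>
      simp only [Algebra.TensorProduct.tmul_mul_tmul]
      rw [mul_assoc δ, mul_assoc δ, mul_assoc δ, mul_assoc δ, mul_assoc γ,
        commute_of_mem_even hγ, commute_of_mem_even hγ' β]

lemma mul_odd_mul_odd {A : SuperAlgebra F} {γ γ' : Grassmann F}
    (hγ : γ ∈ grassmannPart F 1) (hγ' : γ' ∈ grassmannPart F 1) (g : A.carrier)
    (w : Grassmann F ⊗[F] A.carrier) :
    w * (γ ⊗ₜ g) * (γ' ⊗ₜ g) + w * (γ' ⊗ₜ g) * (γ ⊗ₜ g) = 0 := by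
  induction w using TensorProduct.induction_on with
  | zero => simp only [zero_mul, add_zero]
  | add w w' hw hw' =>
    simp only [add_mul]
    rw [add_add_add_comm, hw, hw', add_zero]
  | tmul δ w =>
    simp only [Algebra.TensorProduct.tmul_mul_tmul]
    rw [mul_assoc, anticommute_of_mem_odd hγ hγ', mul_neg, ← mul_assoc, TensorProduct.neg_tmul,
      neg_add_cancel]

variable (F) in
/-- A homogeneous element of the Grassmann algebra of given parity: `1` or a generator. -/
def parityGen (p : ℕ × ZMod 2) : Grassmann F := if p.2 = 0 then 1 else gen F p.1

lemma parityGen_mem (p : ℕ × ZMod 2) : parityGen F p ∈ grassmannPart F p.2 := by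
  have h2 : ∀ i : ZMod 2, i = 0 ∨ i = 1 := by decide
  obtain ⟨n, i⟩ := p
  rcases h2 i with rfl | rfl
  · exact one_mem_grassmannPart
  · exact gen_mem n

lemma parityGen_prod_ne_zero {l : List (ℕ × ZMod 2)} (hl : (l.map Prod.fst).Nodup) :
    (l.map (parityGen F)).prod ≠ 0 := by
  have h : (l.map (parityGen F)).prod
      = (((l.filter (·.2 ≠ 0)).map Prod.fst).map (gen F)).prod := by
    clear hl
    induction l with
    | nil => rfl
    | cons p l ih =>
      by_cases hp : p.2 = 0 <;> simp [parityGen, hp, ih]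
  rw [h]
  exact gen_prod_ne_zero (hl.sublist (List.filter_sublist.map _))

variable [CharZero F]

/-- Coefficients `1` or distinct generators have a nonzero product, so the identity descends from
the envelope to the superalgebra. -/
lemma mul_mul_mul_eq_zero_of_homogeneous {A : SuperAlgebra F}
    (hA : A ∈ superVariety (metabelianJordan F)) {i j k l : ZMod 2} {a b c d : A.carrier}
    (ha : a ∈ A.part i) (hb : b ∈ A.part j) (hc : c ∈ A.part k) (hd : d ∈ A.part l) :
    (a * b) * (c * d) = 0 := by
  have h := congrArg (envelopeIncl A) (mul_mul_mul_eq_zero hA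
    (envelopeMk A _ (tmul_mem_envelopeSubspace A (parityGen_mem (0, i)) ha))
    (envelopeMk A _ (tmul_mem_envelopeSubspace A (parityGen_mem (1, j)) hb))
    (envelopeMk A _ (tmul_mem_envelopeSubspace A (parityGen_mem (2, k)) hc))
    (envelopeMk A _ (tmul_mem_envelopeSubspace A (parityGen_mem (3, l)) hd)))
  simp only [map_mul, map_zero, envelopeIncl_mk, Algebra.TensorProduct.tmul_mul_tmul] at h
  refine (eq_zero_or_eq_zero_of_tmul h).resolve_left ?_
  have := parityGen_prod_ne_zero (F := F) (l := [(0, i), (1, j), (2, k), (3, l)]) (by simp)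
  simpa [mul_assoc] using this

/-- Metabelianity of the envelope is not enough: `γ ⊗ (c * d)` need not be a product there, for
instance with `γ = 1` and odd `c, d`. The identity is therefore used inside `A`. -/
lemma mul_mul_tmul_eq_zero {A : SuperAlgebra F} (hA : A ∈ superVariety (metabelianJordan F))
    {k l : ZMod 2} {c d : A.carrier} (hc : c ∈ A.part k) (hd : d ∈ A.part l) (γ : Grassmann F)
    {x y : Grassmann F ⊗[F] A.carrier} (hx : x ∈ envelopeSubspace A)
    (hy : y ∈ envelopeSubspace A) : x * y * (γ ⊗ₜ (c * d)) = 0 := by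
  refine envelopeSubspace_induction A (P := fun x => x * y * (γ ⊗ₜ (c * d)) = 0) ?_ ?_ ?_ hx
  · simp only [zero_mul]
  · intro x x' hx hx'
    rw [add_mul, add_mul, hx, hx', add_zero]
  · intro i g a hg ha
    refine envelopeSubspace_induction A
      (P := fun y => g ⊗ₜ a * y * (γ ⊗ₜ (c * d)) = 0) ?_ ?_ ?_ hy
    · simp only [mul_zero, zero_mul]
    · intro y y' hy hy'
      rw [mul_add, add_mul, hy, hy', add_zero]
    · intro j h b hh hb
      simp only [Algebra.TensorProduct.tmul_mul_tmul]
      rw [mul_mul_mul_eq_zero_of_homogeneous hA ha hb hc hd, TensorProduct.tmul_zero]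

lemma satisfiesSuper_freeSuperAlgebra_symProd (r : ℕ) {s : ℕ} (hs : s ≤ 1) :
    SatisfiesSuper (freeSuperAlgebra (genParity r s) (superVariety (metabelianJordan F)))
      (symProd (var F) (2 * r + 1)) := by
  have hA : freeSuperAlgebra (genParity r s) (superVariety (metabelianJordan F))
    ∈ superVariety (metabelianJordan F) := freeSuperAlgebra_mem _ _
  set A := freeSuperAlgebra (genParity r s) (superVariety (metabelianJordan F)) with hAdef
  let π : FreeNonUnitalNonAssocAlgebra F (Fin r ⊕ Fin s) →ₗ[F] A.carrier :=
    quotientMk _ (superRelations_isIdeal (genParity r s) (superVariety (metabelianJordan F)))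
  have hπ : ∀ p q, π (p * q) = π p * π q := fun p q => quotientMk_mul _ _ p q
  let g : Fin r ⊕ Fin s → A.carrier := fun x => π (MonoidAlgebra.single (FreeMagma.of x) 1)
  -- This is where `s ≤ 1` enters: any two odd entries involve the same generator, so their right
  -- multiplications anticommute.
  have : Subsingleton (Fin s) := Fin.subsingleton_iff_le_one.2 hs
  intro a
  rw [lift_symProd]
  have hB : grassmannEnvelope A ∈ metabelianJordan F := hA
  refine symProd_eq_zero hB
    (fun i => {z | ∃ γ ∈ grassmannPart F 0, envelopeIncl A z = γ ⊗ₜ g (.inl i)})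
    {z | ∃ j, ∃ γ ∈ grassmannPart F 1, envelopeIncl A z = γ ⊗ₜ g (.inr j)}
    {z | ∃ γ : Grassmann F, ∃ (k l : ZMod 2), ∃ c ∈ A.part k, ∃ d ∈ A.part l,
      envelopeIncl A z = γ ⊗ₜ (c * d)}
    (fun z => ?_) ?_ ?_ ?_ a
  · set M := AddSubmonoid.closure (_ : Set (grassmannEnvelope A).carrier) with hM
    suffices ∃ z' ∈ M, envelopeIncl A z' = envelopeIncl A z by
      obtain ⟨z', hz', h⟩ := this
      rwa [envelopeIncl_injective A h] at hz'
    refine envelopeSubspace_induction A (P := fun x => ∃ z' ∈ M, envelopeIncl A z' = x)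
      ⟨0, zero_mem _, map_zero _⟩ ?_ ?_ (envelopeIncl_mem A z)
    · rintro _ _ ⟨z, hz, rfl⟩ ⟨z', hz', rfl⟩
      exact ⟨z + z', add_mem hz hz', map_add _ _ _⟩
    · rintro i γ _ hγ ⟨p, hp, rfl⟩
      change ∃ z' ∈ M, envelopeIncl A z' = γ ⊗ₜ π p
      induction hp using Submodule.span_induction generalizing γ with
      | zero => exact ⟨0, zero_mem _, by rw [map_zero, map_zero, TensorProduct.tmul_zero]⟩
      | add p q _ _ hp hq =>
        obtain ⟨z, hz, h⟩ := hp γ hγ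
        obtain ⟨z', hz', h'⟩ := hq γ hγ
        exact ⟨z + z', add_mem hz hz', by rw [map_add, map_add, TensorProduct.tmul_add, h, h']⟩
      | smul c p _ hp =>
        obtain ⟨z, hz, h⟩ := hp (c • γ) (Submodule.smul_mem _ _ hγ)
        exact ⟨z, hz, by rw [h, map_smul, TensorProduct.smul_tmul]⟩
      | mem p hp =>
        obtain ⟨w, hw, rfl⟩ := hp
        have hmem : π (MonoidAlgebra.single w 1) ∈ A.part i :=
          ⟨_, Submodule.subset_span ⟨w, hw, rfl⟩, rfl⟩
        refine ⟨envelopeMk A _ (tmul_mem_envelopeSubspace A hγ hmem),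
          AddSubmonoid.subset_closure ?_, rfl⟩
        cases w with
        | of x =>
          obtain rfl : genParity r s x = i := hw
          rcases x with j | j
          · exact Or.inl (Or.inl (Set.mem_iUnion.2 ⟨j, γ, hγ, rfl⟩))
          · exact Or.inl (Or.inr ⟨j, γ, hγ, rfl⟩)
        | mul v w =>
          refine Or.inr ⟨γ, _, _, π (MonoidAlgebra.single v 1),
            ⟨_, Submodule.subset_span ⟨v, rfl, rfl⟩, rfl⟩, π (MonoidAlgebra.single w 1),
            ⟨_, Submodule.subset_span ⟨w, rfl, rfl⟩, rfl⟩, ?_⟩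
          rw [envelopeIncl_mk, ← hπ, MonoidAlgebra.single_mul_single, mul_one]
          rfl
  · rintro i y ⟨γ, hγ, h⟩ y' ⟨γ', hγ', h'⟩ u v b
    have h₁ : u * v * y * b * y' = u * v * y' * b * y := envelopeIncl_injective A (by
      simp only [map_mul, h, h']
      exact mul_even_mul_mul_even hγ hγ' _ _ _)
    exact eq_zero_of_eq_neg ((mul_mul_mul_skew hB ⟨u, v, rfl⟩ _ _ _).trans
      (congrArg Neg.neg h₁.symm))
  · rintro y ⟨j, γ, hγ, h⟩ y' ⟨j', γ', hγ', h'⟩ u v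
    obtain rfl := Subsingleton.elim j j'
    refine envelopeIncl_injective A ?_
    simp only [map_mul, map_add, map_zero, h, h']
    exact mul_odd_mul_odd hγ hγ' _ _
  · rintro z ⟨γ, k, l, c, hc, d, hd, h⟩ u v
    refine envelopeIncl_injective A ?_
    simp only [map_mul, map_zero, h]
    exact mul_mul_tmul_eq_zero hA hc hd γ (envelopeIncl_mem A u) (envelopeIncl_mem A v)

end FreeSuperAlgebra

/-! ### The basic rank and the basic spectrum -/

variable [CharZero F]

variable (F) in
-- The Grassmann envelope of the zigzag superalgebra is an ordinary algebra of the variety violating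
-- a `symProd` identity of the free algebra of rank `r`.
lemma rankSubvariety_ne (r : ℕ) : rankSubvariety (metabelianJordan F) r ≠ metabelianJordan F := by
  intro h
  have h₁ : grassmannEnvelope (zigzagAlgebra F) ∈ rankSubvariety (metabelianJordan F) r := by
    rw [h]
    exact zigzagAlgebra_mem F
  exact not_satisfiesSuper_zigzagAlgebra_symProd F _ (h₁ _ (satisfies_freeAlgebra_symProd r))

variable (F) in
theorem basicRank_metabelianJordan : basicRank (metabelianJordan F) = ⊤ := by
  simp [basicRank, rankSubvariety_ne F]

lemma two_le_of_superRankSubvariety_eq {r s : ℕ}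
    (h : superRankSubvariety (metabelianJordan F) r s = superVariety (metabelianJordan F)) :
    2 ≤ s := by
  by_contra hs
  have h₁ : zigzagAlgebra F ∈ superRankSubvariety (metabelianJordan F) r s := by
    rw [h]
    exact zigzagAlgebra_mem F
  exact not_satisfiesSuper_zigzagAlgebra_symProd F _
    (h₁ _ (isMultilinear_symProd _) (satisfiesSuper_freeSuperAlgebra_symProd r (by omega)))

variable (F) in
theorem basicSpectrum_metabelianJordan :
    basicSpectrum (metabelianJordan F) = {((0, 2) : ℕ × ℕ)} := by
  have hle : ∀ q : ℕ × ℕ, superRankSubvariety (metabelianJordan F) q.1 q.2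
      = superVariety (metabelianJordan F) → (0, 2) ≤ q := fun q hq =>
    Prod.mk_le_mk.2 ⟨Nat.zero_le _, two_le_of_superRankSubvariety_eq hq⟩
  ext p
  constructor
  · intro hp
    exact le_antisymm (hp.2 (superRankSubvariety_zero_two F) (hle p hp.1)) (hle p hp.1)
  · rintro rfl
    exact ⟨superRankSubvariety_zero_two F, fun q hq _ => hle q hq⟩

end SuperRank

end

theorem mainTheorem4 (F : Type u) [Field F] [CharZero F] :
    SuperRank.basicSpectrum (SuperRank.metabelianJordan F) = {((0, 2) : ℕ × ℕ)} ∧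
      SuperRank.basicRank (SuperRank.metabelianJordan F) = ⊤ :=
  ⟨SuperRank.basicSpectrum_metabelianJordan F, SuperRank.basicRank_metabelianJordan F⟩
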